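/- Let $n\in\mathbb N$ and $\hbar>0$. Write points of phase space as $z=(x,p)\in\mathbb R^n\times\mathbb R^n=\mathbb R^{2n}$ with the Euclidean norm, let $B^{2n}(z_0,\sqrt\hbar)$ be the closed ball of centre $z_0$ and radius $\sqrt\hbar$, $B^{2n}(\sqrt\hbar)=B^{2n}(0,\sqrt\hbar)$, and $T(z_0)z=z+z_0$. Let $\operatorname{Sp}(n)$ be the group of real symplectic $2n\times 2n$ matrices and $\operatorname{ISp}(n)$ the group of all maps $S\,T(z_0)$, $S\in\operatorname{Sp}(n)$, $z_0\in\mathbb R^{2n}$. Let $\operatorname{QB}(n)$ be the set of quantum blobs $S(B^{2n}(z_0,\sqrt\hbar))$ ($S\in\operatorname{Sp}(n)$, $z_0\in\mathbb R^{2n}$) and $\operatorname{QB}_0(n)$ the set of centered ones, $S(B^{2n}(\sqrt\hbar))$. On $L^2(\mathbb R^n)$ let $$\widehat T(x_0,p_0)\psi(x)=e^{\frac i\hbar(p_0\cdot x-\frac12p_0\cdot x_0)}\psi(x-x_0).$$ Let $\operatorname{Mp}(n)$ be the group of unitary operators generated by $$\widehat J\psi(x)=\left(\tfrac1{2\pi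 i\hbar}\right)^{n/2}\!\int e^{-\frac i\hbar x\cdot x'}\psi(x')\,d^nx',\qquad \widehat V_P\psi(x)=e^{-\frac i{2\hbar}Px\cdot x}\psi(x),\qquad \widehat M_{L,m}\psi(x)=i^m\sqrt{|\det L|}\,\psi(Lx),$$ where $P$ is real symmetric, $L$ is real invertible, and $m\in\mathbb Z$ is such that $m\pi$ is an argument of $\det L$ (the first formula is extended to $L^2$ by continuity). Let $\operatorname{IMp}(n)$ be the group of unitary operators generated by $\operatorname{Mp}(n)$ and the $\widehat T(z_0)$, $z_0\in\mathbb R^{2n}$. For real symmetric $n\times n$ matrices $A,B$ with $A$ positive definite put $$\psi_{AB}(x)=e^{i\gamma}\left(\tfrac1{\pi\hbar}\right)^{n/4}(\det A)^{1/4}e^{-\frac1{2\hbar}(A+iB)x\cdot x}\quad(\gamma\in\mathbb R\text{ arbitrary}),\qquad S_{AB}=\begin{pmatrix}A^{-1/2}&0\\-BA^{-1/2}&A^{1/2}\end{pmatrix},\qquad G_{AB}=(S_{AB}S_{AB}^T)^{-1}.$$ Let $\operatorname{Gauss}(n)$ be the set of all Gaussian wavepackets $\widehat T(z_0)\psi_{AB}$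 and $\operatorname{Gauss}_0(n)$ the set of the centered ones $\psi_{AB}$; wavepackets that differ only by a constant phase factor are identified. The Wigner transform of $\psi\in L^2(\mathbb R^n)$ is $$W\psi(x,p)=\left(\tfrac1{2\pi\hbar}\right)^n\int e^{-\frac i\hbar p\cdot y}\,\psi(x+\tfrac12y)\,\overline{\psi(x-\tfrac12y)}\,d^ny .$$ (i) Each $S_{AB}$ is symplectic, and $$\widehat T(z_0)\psi_{AB}\longmapsto T(z_0)S_{AB}(B^{2n}(\sqrt\hbar))$$ is a well-defined bijection $\Phi:\operatorname{Gauss}(n)\to\operatorname{QB}(n)$, which maps $\operatorname{Gauss}_0(n)$ onto $\operatorname{QB}_0(n)$. It is obtained through the Wigner transform: a function $\psi\in L^2(\mathbb R^n)$ represents the state $\widehat T(z_0)\psi_{AB}$ if and only if $$W\psi(z)=(\pi\hbar)^{-n}e^{-\frac1\hbar G_{AB}(z-z_0)\cdot(z-z_0)}\quad\text{for all }z,$$ and the corresponding quantum blob is the ellipsoid $\{z: G_{AB}(z-z_0)\cdot(z-z_0)\le\hbar\}$. (ii) There are surjective group homomorphisms $\pi:\operatorname{Mp}(n)\to\operatorname{Sp}(n)$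 and $\pi':\operatorname{IMp}(n)\to\operatorname{ISp}(n)$ (the natural projections) with $$\pi(\widehat J)=\begin{pmatrix}0&I\\-I&0\end{pmatrix},\quad \pi(\widehat V_P)=\begin{pmatrix}I&0\\-P&I\end{pmatrix},\quad \pi(\widehat M_{L,m})=\begin{pmatrix}L^{-1}&0\\0&L^T\end{pmatrix},\quad \pi'(\widehat S\,\widehat T(z_0))=\pi(\widehat S)\,T(z_0)$$ for $\widehat S\in\operatorname{Mp}(n)$, $z_0\in\mathbb R^{2n}$. The group $\operatorname{Sp}(n)$ acts transitively on $\operatorname{QB}_0(n)$, and this induces a transitive action of $\operatorname{Mp}(n)$ on $\operatorname{Gauss}_0(n)$: every $\widehat S\in\operatorname{Mp}(n)$ maps $\operatorname{Gauss}_0(n)$ into itself, $\Phi(\widehat S\psi)=\pi(\widehat S)(\Phi(\psi))$ for $\psi\in\operatorname{Gauss}_0(n)$, and the action is transitive. Likewise $\operatorname{ISp}(n)$ acts transitively on $\operatorname{QB}(n)$, and this induces a transitive action of $\operatorname{IMp}(n)$ on $\operatorname{Gauss}(n)$: every $U\in\operatorname{IMp}(n)$ maps $\operatorname{Gauss}(n)$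 into itself, $\Phi(U\psi)=\pi'(U)(\Phi(\psi))$ for $\psi\in\operatorname{Gauss}(n)$, and for any $\psi,\psi'\in\operatorname{Gauss}(n)$ there are $\widehat S\in\operatorname{Mp}(n)$ and $z_0\in\mathbb R^{2n}$ with $\widehat S\,\widehat T(z_0)\psi=\psi'$ up to a phase factor. -/

import Mathlib

open MeasureTheory Matrix
open scoped MatrixOrder FourierTransform

noncomputable section

namespace QuantumBlob

/-- Configuration space `ℝⁿ` with its Euclidean structure. -/
abbrev Config (n : ℕ) := EuclideanSpace ℝ (Fin n)

/-- Phase space `ℝ²ⁿ` with its Euclidean structure; a point is `z = (x, p)`, the coordinates of `x`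
being indexed by `Sum.inl` and those of `p` by `Sum.inr`. -/
abbrev Phase (n : ℕ) := EuclideanSpace ℝ (Fin n ⊕ Fin n)

/-- The Hilbert space `L²(ℝⁿ; ℂ)`. -/
abbrev L2 (n : ℕ) := Lp ℂ 2 (volume : Measure (Config n))

/-- The group of unitary operators on `L²(ℝⁿ; ℂ)`. -/
abbrev UnitaryOp (n : ℕ) := L2 n ≃ₗᵢ[ℂ] L2 n

/-- The symplectic group `Sp(n)` of real `2n × 2n` matrices. -/
abbrev Sp (n : ℕ) := Matrix.symplecticGroup (Fin n) ℝ

/-- The position component of `z = (x, p)`. -/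
def pos {n : ℕ} (z : Phase n) : Config n := WithLp.toLp 2 fun i => z (Sum.inl i)

/-- The momentum component of `z = (x, p)`. -/
def mom {n : ℕ} (z : Phase n) : Config n := WithLp.toLp 2 fun i => z (Sum.inr i)

/-- The quadratic form `M v · v` of a real matrix. -/
def quad {ι : Type*} [Fintype ι] (M : Matrix ι ι ℝ) (v : EuclideanSpace ℝ ι) : ℝ :=
  (M *ᵥ v.ofLp) ⬝ᵥ v.ofLp

/-- The linear map of a Euclidean space given by a square matrix. -/
def lin {ι : Type*} [Fintype ι] (M : Matrix ι ι ℝ) (v : EuclideanSpace ℝ ι) : EuclideanSpace ℝ ι :=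
  WithLp.toLp 2 (M *ᵥ v.ofLp)

@[simp]
theorem lin_one {ι : Type*} [Fintype ι] [DecidableEq ι] (v : EuclideanSpace ℝ ι) :
    lin 1 v = v := by
  simp [lin]

theorem lin_mul {ι : Type*} [Fintype ι] (M N : Matrix ι ι ℝ) (v : EuclideanSpace ℝ ι) :
    lin (M * N) v = lin M (lin N v) := by
  simp [lin, Matrix.mulVec_mulVec]

theorem lin_add {ι : Type*} [Fintype ι] (M : Matrix ι ι ℝ) (v w : EuclideanSpace ℝ ι) :
    lin M (v + w) = lin M v + lin M w := by
  simp [lin, Matrix.mulVec_add]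

/-! ### Phase space: symplectic and affine symplectic transformations, quantum blobs -/

/-- `Sp(n)` as a group of transformations of phase space. -/
def spMap (n : ℕ) : Sp n →* Equiv.Perm (Phase n) where
  toFun S :=
    { toFun := lin (S : Matrix (Fin n ⊕ Fin n) (Fin n ⊕ Fin n) ℝ)
      invFun := lin ((S⁻¹ : Sp n) : Matrix (Fin n ⊕ Fin n) (Fin n ⊕ Fin n) ℝ)
      left_inv := fun z => by
        rw [← lin_mul, ← Submonoid.coe_mul, inv_mul_cancel, Submonoid.coe_one, lin_one]
      right_inv := fun z => by
        rw [← lin_mul, ← Submonoid.coe_mul, mul_inv_cancel, Submonoid.coe_one, lin_one] }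
  map_one' := by ext1 z; exact lin_one z
  map_mul' S S' := by ext1 z; exact lin_mul _ _ z

/-- The phase space translation `T(z₀) : z ↦ z + z₀`. -/
def translation {n : ℕ} (z₀ : Phase n) : Equiv.Perm (Phase n) := Equiv.addRight z₀

theorem translation_mul_spMap {n : ℕ} (S : Sp n) (z₀ : Phase n) :
    spMap n S * translation z₀ = translation (spMap n S z₀) * spMap n S := by
  ext1 z
  exact lin_add _ z z₀

/-- The affine symplectic group `ISp(n)`: all products `S T(z₀)`, with `S ∈ Sp(n)` and
`z₀ ∈ ℝ²ⁿ`. -/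
def ISp (n : ℕ) : Subgroup (Equiv.Perm (Phase n)) where
  carrier := {f | ∃ (S : Sp n) (z₀ : Phase n), f = spMap n S * translation z₀}
  one_mem' := ⟨1, 0, by ext1 z; simp [translation]⟩
  mul_mem' := by
    rintro _ _ ⟨S, z, rfl⟩ ⟨S', z', rfl⟩
    refine ⟨S * S', z' + spMap n S'⁻¹ z, ?_⟩
    have h : translation z * spMap n S' = spMap n S' * translation (spMap n S'⁻¹ z) := by
      rw [translation_mul_spMap, map_inv, ← Equiv.Perm.mul_apply, mul_inv_cancel,
        Equiv.Perm.one_apply]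
    have h' : translation (spMap n S'⁻¹ z) * translation z'
        = translation (z' + spMap n S'⁻¹ z) := by
      ext1 v
      simp [translation, add_assoc]
    rw [map_mul, mul_assoc, ← mul_assoc _ _ (translation z'), h, mul_assoc, h', mul_assoc]
  inv_mem' := by
    rintro _ ⟨S, z, rfl⟩
    refine ⟨S⁻¹, spMap n S (-z), ?_⟩
    have h : (translation z)⁻¹ = translation (-z) := by
      ext1 v
      simp [translation, Equiv.Perm.inv_def]
    rw [_root_.mul_inv_rev, h, translation_mul_spMap, ← map_inv, ← Equiv.Perm.mul_apply,
      ← map_mul, inv_mul_cancel, map_one, Equiv.Perm.one_apply]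

/-- The set `QB(n)` of quantum blobs: the images of the balls `B²ⁿ(z₀, √ħ)` by symplectic
transformations. -/
def QB (n : ℕ) (ħ : ℝ) : Set (Set (Phase n)) :=
  {Q | ∃ (S : Sp n) (z₀ : Phase n), Q = spMap n S '' Metric.closedBall z₀ √ħ}

/-- The set `QB₀(n)` of centered quantum blobs. -/
def QB₀ (n : ℕ) (ħ : ℝ) : Set (Set (Phase n)) :=
  {Q | ∃ S : Sp n, Q = spMap n S '' Metric.closedBall 0 √ħ}

/-- The matrix `S_{AB}`, with blocks `A^{-1/2}`, `0`, `-B A^{-1/2}`, `A^{1/2}`. -/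
def matS {n : ℕ} (A B : Matrix (Fin n) (Fin n) ℝ) :
    Matrix (Fin n ⊕ Fin n) (Fin n ⊕ Fin n) ℝ :=
  Matrix.fromBlocks (CFC.sqrt A)⁻¹ 0 (-(B * (CFC.sqrt A)⁻¹)) (CFC.sqrt A)

/-- The matrix `G = (S_{AB} S_{AB}ᵀ)⁻¹`. -/
def matG {n : ℕ} (A B : Matrix (Fin n) (Fin n) ℝ) :
    Matrix (Fin n ⊕ Fin n) (Fin n ⊕ Fin n) ℝ :=
  (matS A B * (matS A B)ᵀ)⁻¹

/-! ### Unitary operators on `L²` of the form `ψ ↦ w · (ψ ∘ e)` -/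

section WeightedComp

variable {n : ℕ}

theorem eLpNorm_weightedComp (w : Config n → ℂ) (e : Config n ≃ᵐ Config n) {r : ℝ} (hr : 0 < r)
    (hw' : ∀ x, ‖w x‖ = r)
    (he : (volume : Measure (Config n)).map e = ENNReal.ofReal (r ^ 2)⁻¹ • volume)
    (f : Config n → ℂ) :
    eLpNorm (fun x => w x * f (e x)) 2 volume = eLpNorm f 2 volume := by
  have h1 : eLpNorm (fun x => w x * f (e x)) 2 volume
      = eLpNorm ((r : ℂ) • (f ∘ e)) 2 volume := by
    refine eLpNorm_congr_norm_ae (Filter.Eventually.of_forall fun x => ?_)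
    simp [hw', abs_of_pos hr]
  rw [h1, eLpNorm_const_smul, ← e.measurableEmbedding.eLpNorm_map_measure, he,
    eLpNorm_smul_measure_of_ne_top (by norm_num), smul_eq_mul, ← mul_assoc]
  have h2 : ‖(r : ℂ)‖ₑ = ENNReal.ofReal r := by
    rw [← ofReal_norm, Complex.norm_real, Real.norm_of_nonneg hr.le]
  have h3 : ENNReal.ofReal (r ^ 2)⁻¹ ^ (1 / (2 : ENNReal)).toReal = ENNReal.ofReal r⁻¹ := by
    rw [ENNReal.ofReal_rpow_of_pos (by positivity)]
    congr 1
    rw [← inv_pow, ENNReal.toReal_div, ENNReal.toReal_one, ENNReal.toReal_ofNat,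
      ← Real.sqrt_eq_rpow, Real.sqrt_sq (inv_nonneg.2 hr.le)]
  rw [h2, h3, ← ENNReal.ofReal_mul hr.le, mul_inv_cancel₀ hr.ne', ENNReal.ofReal_one, one_mul]

theorem memLp_weightedComp {w : Config n → ℂ} (hw : Measurable w) (e : Config n ≃ᵐ Config n)
    {r : ℝ} (hr : 0 < r) (hw' : ∀ x, ‖w x‖ = r)
    (he : (volume : Measure (Config n)).map e = ENNReal.ofReal (r ^ 2)⁻¹ • volume)
    {f : Config n → ℂ} (hf : MemLp f 2 volume) :
    MemLp (fun x => w x * f (e x)) 2 volume := by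
  refine ⟨hw.aestronglyMeasurable.mul ?_, ?_⟩
  · refine hf.1.comp_quasiMeasurePreserving ⟨e.measurable, ?_⟩
    rw [he]
    exact Measure.smul_absolutelyContinuous
  · rw [eLpNorm_weightedComp w e hr hw' he]
    exact hf.2

theorem ae_comp_of_map {e : Config n ≃ᵐ Config n} {c : ENNReal}
    (he : (volume : Measure (Config n)).map e = c • volume) {f g : Config n → ℂ}
    (h : f =ᵐ[volume] g) : ∀ᵐ x ∂(volume : Measure (Config n)), f (e x) = g (e x) := by
  refine Measure.QuasiMeasurePreserving.ae ⟨e.measurable, ?_⟩ h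
  rw [he]
  exact Measure.smul_absolutelyContinuous

theorem map_symm_of_map {e : Config n ≃ᵐ Config n} {r : ℝ} (hr : 0 < r)
    (he : (volume : Measure (Config n)).map e = ENNReal.ofReal (r ^ 2)⁻¹ • volume) :
    (volume : Measure (Config n)).map e.symm = ENNReal.ofReal (r⁻¹ ^ 2)⁻¹ • volume := by
  have h : (volume : Measure (Config n)) = ENNReal.ofReal (r ^ 2) • volume.map e := by
    rw [he, smul_smul, ← ENNReal.ofReal_mul (by positivity), mul_inv_cancel₀ (by positivity),
      ENNReal.ofReal_one, one_smul]
  conv_lhs => rw [h]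
  rw [Measure.map_smul, MeasurableEquiv.map_symm_map]
  simp

/-- The unitary operator `ψ ↦ w · (ψ ∘ e)`, where the weight `w` has constant modulus `r` and `e`
multiplies Lebesgue measure by `r²`. -/
def weightedComp (w : Config n → ℂ) (hw : Measurable w) (e : Config n ≃ᵐ Config n)
    (r : ℝ) (hr : 0 < r) (hw' : ∀ x, ‖w x‖ = r)
    (he : (volume : Measure (Config n)).map e = ENNReal.ofReal (r ^ 2)⁻¹ • volume) :
    UnitaryOp n :=
  LinearIsometryEquiv.ofSurjective
    { toFun := fun ψ => (memLp_weightedComp hw e hr hw' he (Lp.memLp ψ)).toLp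
      map_add' := fun ψ φ => by
        ext1
        filter_upwards [MemLp.coeFn_toLp (memLp_weightedComp hw e hr hw' he (Lp.memLp (ψ + φ))),
          MemLp.coeFn_toLp (memLp_weightedComp hw e hr hw' he (Lp.memLp ψ)),
          MemLp.coeFn_toLp (memLp_weightedComp hw e hr hw' he (Lp.memLp φ)),
          Lp.coeFn_add (MemLp.toLp _ (memLp_weightedComp hw e hr hw' he (Lp.memLp ψ)))
            (MemLp.toLp _ (memLp_weightedComp hw e hr hw' he (Lp.memLp φ))),
          ae_comp_of_map he (Lp.coeFn_add ψ φ)] with x h1 h2 h3 h4 h5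
        rw [h4, h1, Pi.add_apply, h2, h3, h5, Pi.add_apply, mul_add]
      map_smul' := fun c ψ => by
        ext1
        filter_upwards [MemLp.coeFn_toLp (memLp_weightedComp hw e hr hw' he (Lp.memLp (c • ψ))),
          MemLp.coeFn_toLp (memLp_weightedComp hw e hr hw' he (Lp.memLp ψ)),
          Lp.coeFn_smul c (MemLp.toLp _ (memLp_weightedComp hw e hr hw' he (Lp.memLp ψ))),
          ae_comp_of_map he (Lp.coeFn_smul c ψ)] with x h1 h2 h4 h5
        rw [RingHom.id_apply, h4, h1, Pi.smul_apply, h2, h5, Pi.smul_apply, smul_eq_mul,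
          smul_eq_mul]
        ring
      norm_map' := fun ψ => by
        rw [LinearMap.coe_mk, AddHom.coe_mk, Lp.norm_toLp, eLpNorm_weightedComp w e hr hw' he,
          Lp.norm_def] }
    (fun φ => by
      have hm : Measurable fun x => (w (e.symm x))⁻¹ := (hw.comp e.symm.measurable).inv
      have hφ := memLp_weightedComp hm e.symm (inv_pos.2 hr) (fun x => by simp [hw'])
        (map_symm_of_map hr he) (Lp.memLp φ)
      refine ⟨hφ.toLp, ?_⟩
      ext1
      refine (MemLp.coeFn_toLp (memLp_weightedComp hw e hr hw' he (Lp.memLp hφ.toLp))).trans ?_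
      filter_upwards [ae_comp_of_map he hφ.coeFn_toLp] with x h
      have hx : w x ≠ 0 := fun h0 => hr.ne' (by rw [← hw' x, h0, norm_zero])
      rw [h, MeasurableEquiv.symm_apply_apply, mul_inv_cancel_left₀ hx])

theorem weightedComp_apply (w : Config n → ℂ) (hw : Measurable w) (e : Config n ≃ᵐ Config n)
    (r : ℝ) (hr : 0 < r) (hw' : ∀ x, ‖w x‖ = r)
    (he : (volume : Measure (Config n)).map e = ENNReal.ofReal (r ^ 2)⁻¹ • volume) (ψ : L2 n) :
    weightedComp w hw e r hr hw' he ψ =ᵐ[volume] fun x => w x * ψ (e x) :=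
  MemLp.coeFn_toLp (memLp_weightedComp hw e hr hw' he (Lp.memLp ψ))

end WeightedComp

/-! ### The metaplectic group and the Heisenberg displacement operators -/

section Operators

variable {n : ℕ}

@[fun_prop]
theorem continuous_quad {ι : Type*} [Fintype ι] (M : Matrix ι ι ℝ) : Continuous (quad M) := by
  unfold quad dotProduct Matrix.mulVec dotProduct
  fun_prop

/-- The Heisenberg displacement operator
`T̂(x₀, p₀) ψ(x) = exp((i/ħ)(p₀ · x - ½ p₀ · x₀)) ψ(x - x₀)`. -/
def heisenberg (ħ : ℝ) (z₀ : Phase n) : UnitaryOp n :=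
  weightedComp
    (fun x => Complex.exp
      (((1 / ħ * (inner ℝ (mom z₀) x - 1 / 2 * inner ℝ (mom z₀) (pos z₀)) : ℝ) : ℂ) * Complex.I))
    (by fun_prop) (MeasurableEquiv.subRight (pos z₀)) 1 one_pos
    (fun x => Complex.norm_exp_ofReal_mul_I _)
    (by
      rw [one_pow, inv_one, ENNReal.ofReal_one, one_smul]
      exact (measurePreserving_sub_right volume (pos z₀)).map_eq)

theorem heisenberg_apply (ħ : ℝ) (z₀ : Phase n) (ψ : L2 n) :
    heisenberg ħ z₀ ψ =ᵐ[volume] fun x => Complex.exp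
      (((1 / ħ * (inner ℝ (mom z₀) x - 1 / 2 * inner ℝ (mom z₀) (pos z₀)) : ℝ) : ℂ) * Complex.I)
        * ψ (x - pos z₀) :=
  weightedComp_apply ..

/-- The operator `V̂_P ψ(x) = exp(-(i/2ħ) Px · x) ψ(x)`. -/
def opV (ħ : ℝ) (P : Matrix (Fin n) (Fin n) ℝ) : UnitaryOp n :=
  weightedComp (fun x => Complex.exp (((-(1 / (2 * ħ)) * quad P x : ℝ) : ℂ) * Complex.I))
    (by fun_prop) (MeasurableEquiv.refl _) 1 one_pos
    (fun x => Complex.norm_exp_ofReal_mul_I _)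
    (by
      rw [one_pow, inv_one, ENNReal.ofReal_one, one_smul]
      exact Measure.map_id)

theorem opV_apply (ħ : ℝ) (P : Matrix (Fin n) (Fin n) ℝ) (ψ : L2 n) :
    opV ħ P ψ =ᵐ[volume] fun x =>
      Complex.exp (((-(1 / (2 * ħ)) * quad P x : ℝ) : ℂ) * Complex.I) * ψ x :=
  weightedComp_apply ..

/-- An invertible matrix as a measurable automorphism of `ℝⁿ`. -/
def linEquiv (L : GL (Fin n) ℝ) : Config n ≃ᵐ Config n where
  toFun := lin (L : Matrix (Fin n) (Fin n) ℝ)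
  invFun := lin ((L⁻¹ : GL (Fin n) ℝ) : Matrix (Fin n) (Fin n) ℝ)
  left_inv := fun z => by rw [← lin_mul, Units.inv_mul, lin_one]
  right_inv := fun z => by rw [← lin_mul, Units.mul_inv, lin_one]
  measurable_toFun := (Matrix.toEuclideanLin
    (L : Matrix (Fin n) (Fin n) ℝ)).continuous_of_finiteDimensional.measurable
  measurable_invFun := (Matrix.toEuclideanLin
    ((L⁻¹ : GL (Fin n) ℝ) : Matrix (Fin n) (Fin n) ℝ)).continuous_of_finiteDimensional.measurable

theorem map_linEquiv (L : GL (Fin n) ℝ) :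
    (volume : Measure (Config n)).map (linEquiv L)
      = ENNReal.ofReal |(L : Matrix (Fin n) (Fin n) ℝ).det|⁻¹ • volume := by
  have hd : LinearMap.det (Matrix.toEuclideanLin (L : Matrix (Fin n) (Fin n) ℝ))
      = (L : Matrix (Fin n) (Fin n) ℝ).det := LinearMap.det_toLpLin 2 _
  have h := Measure.map_linearMap_addHaar_eq_smul_addHaar (volume : Measure (Config n))
    (f := Matrix.toEuclideanLin (L : Matrix (Fin n) (Fin n) ℝ))
    (by rw [hd]; exact (Matrix.isUnits_det_units L).ne_zero)
  rw [hd, abs_inv] at h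
  exact h

/-- The unitary operator `ψ ↦ c · (ψ ∘ L)`, where `|c|² = |det L|`. -/
def scaledComp (c : ℂ) (L : GL (Fin n) ℝ)
    (hc : ‖c‖ ^ 2 = |(L : Matrix (Fin n) (Fin n) ℝ).det|) : UnitaryOp n :=
  weightedComp (fun _ => c) measurable_const (linEquiv L) ‖c‖
    (norm_pos_iff.2 fun h => by
      rw [h, norm_zero, zero_pow two_ne_zero, eq_comm, abs_eq_zero] at hc
      exact (Matrix.isUnits_det_units L).ne_zero hc)
    (fun _ => rfl)
    (by rw [hc]; exact map_linEquiv L)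

theorem scaledComp_apply (c : ℂ) (L : GL (Fin n) ℝ)
    (hc : ‖c‖ ^ 2 = |(L : Matrix (Fin n) (Fin n) ℝ).det|) (ψ : L2 n) :
    scaledComp c L hc ψ =ᵐ[volume]
      fun x => c * ψ (lin (L : Matrix (Fin n) (Fin n) ℝ) x) :=
  weightedComp_apply ..

/-- The operator `M̂_{L,m} ψ(x) = iᵐ √|det L| ψ(Lx)`. -/
def opM (L : GL (Fin n) ℝ) (m : ℤ) : UnitaryOp n :=
  scaledComp (Complex.I ^ m * (√|(L : Matrix (Fin n) (Fin n) ℝ).det| : ℝ)) L (by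
    rw [norm_mul, norm_zpow, Complex.norm_I, _root_.one_zpow, one_mul, Complex.norm_real,
      Real.norm_of_nonneg (Real.sqrt_nonneg _), Real.sq_sqrt (abs_nonneg _)])

theorem opM_apply (L : GL (Fin n) ℝ) (m : ℤ) (ψ : L2 n) :
    opM L m ψ =ᵐ[volume] fun x =>
      Complex.I ^ m * (√|(L : Matrix (Fin n) (Fin n) ℝ).det| : ℝ)
        * ψ (lin (L : Matrix (Fin n) (Fin n) ℝ) x) :=
  scaledComp_apply ..

/-- The constant `(1/(2πiħ))^{n/2}` (principal branch). -/
def fourierConst (n : ℕ) (ħ : ℝ) : ℂ := (1 / (2 * Real.pi * Complex.I * ħ)) ^ ((n : ℂ) / 2)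

/-- The homothety of ratio `1/(2πħ)`. -/
def homothety (n : ℕ) {ħ : ℝ} (hħ : 0 < ħ) : GL (Fin n) ℝ :=
  Matrix.GeneralLinearGroup.mkOfDetNeZero ((2 * Real.pi * ħ)⁻¹ • (1 : Matrix (Fin n) (Fin n) ℝ))
    (by rw [Matrix.det_smul, Matrix.det_one, mul_one]; positivity)

theorem norm_fourierConst (n : ℕ) {ħ : ℝ} (hħ : 0 < ħ) :
    ‖fourierConst n ħ‖ ^ 2 = |(homothety n hħ : Matrix (Fin n) (Fin n) ℝ).det| := by
  have hdet : (homothety n hħ : Matrix (Fin n) (Fin n) ℝ).det = ((2 * Real.pi * ħ)⁻¹) ^ n := by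
    change ((2 * Real.pi * ħ)⁻¹ • (1 : Matrix (Fin n) (Fin n) ℝ)).det = _
    simp
  have he : ((n : ℂ) / 2) = (((n : ℝ) / 2 : ℝ) : ℂ) := by push_cast; rfl
  have hn : ‖(1 / (2 * Real.pi * Complex.I * ħ) : ℂ)‖ = (2 * Real.pi * ħ)⁻¹ := by
    simp [abs_of_pos Real.pi_pos, abs_of_pos hħ]
  rw [hdet, abs_of_pos (by positivity), fourierConst, he, Complex.norm_cpow_real, hn,
    ← Real.rpow_natCast, ← Real.rpow_natCast, ← Real.rpow_mul (by positivity)]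
  congr 1
  push_cast
  ring

/-- The operator `Ĵ ψ(x) = (1/(2πiħ))^{n/2} ∫ exp(-(i/ħ) x · x') ψ(x') dx'` on `L²`, that is, the
unitary Fourier transform `𝓕` of `L²` (with kernel `exp(-2πi x · x')`) followed by the substitution
`x ↦ x/(2πħ)` and multiplication by `(1/(2πiħ))^{n/2}`. -/
def opJ (n : ℕ) {ħ : ℝ} (hħ : 0 < ħ) : UnitaryOp n :=
  scaledComp (fourierConst n ħ) (homothety n hħ) (norm_fourierConst n hħ)
    * Lp.fourierTransformₗᵢ (Config n) ℂ

theorem opJ_apply {ħ : ℝ} (hħ : 0 < ħ) (f : SchwartzMap (Config n) ℂ) :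
    opJ n hħ (f.toLp 2) =ᵐ[volume] fun x => fourierConst n ħ *
      ∫ x' : Config n, Complex.exp (-(Complex.I / ħ) * (inner ℝ x x' : ℝ)) * f x' := by
  have h1 : Lp.fourierTransformₗᵢ (Config n) ℂ (f.toLp 2) = (𝓕 f).toLp 2 :=
    SchwartzMap.toLp_fourier_eq f
  have h2 : opJ n hħ (f.toLp 2) = scaledComp (fourierConst n ħ) (homothety n hħ)
      (norm_fourierConst n hħ) ((𝓕 f).toLp 2) := by
    rw [← h1]
    rfl
  rw [h2]
  filter_upwards [scaledComp_apply (fourierConst n ħ) (homothety n hħ)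
      (norm_fourierConst n hħ) ((𝓕 f).toLp 2),
    ae_comp_of_map (map_linEquiv (homothety n hħ))
      (SchwartzMap.coeFn_toLp (𝓕 f) 2 volume)] with x hx hx'
  have h3 : linEquiv (homothety n hħ) x = (2 * Real.pi * ħ)⁻¹ • x := by
    change lin ((2 * Real.pi * ħ)⁻¹ • (1 : Matrix (Fin n) (Fin n) ℝ)) x = _
    ext i
    simp [lin, Matrix.smul_mulVec]
  change _ = fourierConst n ħ * ((𝓕 f).toLp 2) (linEquiv (homothety n hħ) x) at hx
  rw [hx, hx', h3, SchwartzMap.fourier_coe, Real.fourier_eq']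
  congr 1
  refine integral_congr_ae (Filter.Eventually.of_forall fun v => ?_)
  have hħ' : (ħ : ℂ) ≠ 0 := by exact_mod_cast hħ.ne'
  have hpi : (Real.pi : ℂ) ≠ 0 := by exact_mod_cast Real.pi_ne_zero
  simp only [smul_eq_mul]
  congr 2
  rw [real_inner_smul_right, real_inner_comm]
  push_cast
  field_simp

/-- The metaplectic group `Mp(n)`: the group of unitary operators generated by `Ĵ`, the `V̂_P` with
`P` symmetric, and the `M̂_{L,m}` with `L` invertible and `mπ` an argument of `det L`. -/
def Mp (n : ℕ) {ħ : ℝ} (hħ : 0 < ħ) : Subgroup (UnitaryOp n) :=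
  Subgroup.closure
    ({opJ n hħ} ∪ {U | ∃ P : Matrix (Fin n) (Fin n) ℝ, P.IsSymm ∧ U = opV ħ P} ∪
      {U | ∃ (L : GL (Fin n) ℝ) (m : ℤ),
        (-1 : ℝ) ^ m * |(L : Matrix (Fin n) (Fin n) ℝ).det| = (L : Matrix (Fin n) (Fin n) ℝ).det ∧
          U = opM L m})

/-- The inhomogeneous metaplectic group `IMp(n)`: the group of unitary operators generated by
`Mp(n)` and the displacement operators `T̂(z₀)`. -/
def IMp (n : ℕ) {ħ : ℝ} (hħ : 0 < ħ) : Subgroup (UnitaryOp n) :=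
  Subgroup.closure ((Mp n hħ : Set (UnitaryOp n)) ∪ Set.range (heisenberg ħ))

theorem opJ_mem (n : ℕ) {ħ : ℝ} (hħ : 0 < ħ) : opJ n hħ ∈ Mp n hħ :=
  Subgroup.subset_closure (Or.inl (Or.inl rfl))

theorem opV_mem {ħ : ℝ} (hħ : 0 < ħ) {P : Matrix (Fin n) (Fin n) ℝ} (hP : P.IsSymm) :
    opV ħ P ∈ Mp n hħ :=
  Subgroup.subset_closure (Or.inl (Or.inr ⟨P, hP, rfl⟩))

theorem opM_mem {ħ : ℝ} (hħ : 0 < ħ) {L : GL (Fin n) ℝ} {m : ℤ}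
    (hm : (-1 : ℝ) ^ m * |(L : Matrix (Fin n) (Fin n) ℝ).det|
      = (L : Matrix (Fin n) (Fin n) ℝ).det) :
    opM L m ∈ Mp n hħ :=
  Subgroup.subset_closure (Or.inr ⟨L, m, hm, rfl⟩)

theorem Mp_mul_heisenberg_mem {ħ : ℝ} (hħ : 0 < ħ) (U : Mp n hħ) (z₀ : Phase n) :
    (U : UnitaryOp n) * heisenberg ħ z₀ ∈ IMp n hħ :=
  mul_mem (Subgroup.subset_closure (Or.inl U.2)) (Subgroup.subset_closure (Or.inr ⟨z₀, rfl⟩))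

theorem spMap_mul_translation_mem (S : Sp n) (z₀ : Phase n) :
    spMap n S * translation z₀ ∈ ISp n :=
  ⟨S, z₀, rfl⟩

end Operators

/-! ### Gaussian wavepackets and the Wigner transform -/

/-- The state `ψ_{AB}`: the set of all functions
`e^{iγ} (1/(πħ))^{n/4} (det A)^{1/4} exp(-(1/2ħ) (A + iB)x · x)` of `L²`, with `γ` real. -/
def wavepacket {n : ℕ} (ħ : ℝ) (A B : Matrix (Fin n) (Fin n) ℝ) : Set (L2 n) :=
  {ψ | ∃ γ : ℝ, ψ =ᵐ[volume] fun x =>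
    Complex.exp (γ * Complex.I) * (((1 / (Real.pi * ħ)) ^ ((n : ℝ) / 4) : ℝ) : ℂ)
      * ((A.det ^ (1 / 4 : ℝ) : ℝ) : ℂ)
      * Complex.exp (-(1 / (2 * ħ)) * (quad A x + Complex.I * quad B x))}

/-- The displaced state `T̂(z₀) ψ_{AB}`, as a set of functions that differ by phase factors. -/
def gaussState {n : ℕ} (ħ : ℝ) (z₀ : Phase n) (A B : Matrix (Fin n) (Fin n) ℝ) : Set (L2 n) :=
  heisenberg ħ z₀ '' wavepacket ħ A B

/-- The set `Gauss(n)` of Gaussian wavepackets `T̂(z₀) ψ_{AB}`, each up to a phase factor. -/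
def Gauss (n : ℕ) (ħ : ℝ) : Set (Set (L2 n)) :=
  {s | ∃ (z₀ : Phase n) (A B : Matrix (Fin n) (Fin n) ℝ),
    A.PosDef ∧ B.IsSymm ∧ s = gaussState ħ z₀ A B}

/-- The set `Gauss₀(n)` of centered Gaussian wavepackets `ψ_{AB}`, each up to a phase factor. -/
def Gauss₀ (n : ℕ) (ħ : ℝ) : Set (Set (L2 n)) :=
  {s | ∃ A B : Matrix (Fin n) (Fin n) ℝ, A.PosDef ∧ B.IsSymm ∧ s = wavepacket ħ A B}

/-- The Wigner transform
`Wψ(x, p) = (1/(2πħ))ⁿ ∫ exp(-(i/ħ) p · y) ψ(x + y/2) conj(ψ(x - y/2)) dy`. -/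
def wigner {n : ℕ} (ħ : ℝ) (ψ : Config n → ℂ) (z : Phase n) : ℂ :=
  (1 / (2 * Real.pi * ħ)) ^ n * ∫ y : Config n,
    Complex.exp (-(Complex.I / ħ) * (inner ℝ (mom z) y : ℝ))
      * ψ (pos z + (1 / 2 : ℝ) • y) * star (ψ (pos z - (1 / 2 : ℝ) • y))

end QuantumBlob

end

open QuantumBlob

/-!
A unitary operator `U` covers a transformation `f` of phase space when `W(Uψ) ∘ f = Wψ` for all
`ψ`. The generators of `IMp(n)` cover affine symplectic transformations: for the shears, the
dilations and the translations this is a change of variables in the Wigner integral; for `Ĵ` one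
writes `Wψ(z)` as an inner product of parity-reflected translates of `ψ` (Grossmann–Royer) and uses
that `Ĵ` intertwines the translations and commutes with parity. Since Gaussian Wigner transforms
separate the points of phase space, `f` is determined by `U`, and `U ↦ f` is the projection.

By Fourier inversion `Wψ` determines `ψ` up to a phase. So the Gaussian states are exactly the
states whose Wigner transform is that of the ground state transported by some `f ∈ ISp(n)`; that
every `S ∈ Sp(n)` may be replaced by some `S_AB` means that `S Sᵀ = S_AB S_ABᵀ`, a block
factorization. The blob `f(B(√ħ))` is a superlevel set of the Wigner transform, and conversely it
determines the state because an affine map preserving a ball about the origin preserves the norm.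
-/

namespace QuantumBlob

/-! ### Fourier transforms and correlations -/

theorem hasTemperateGrowth_cexp_ofReal_mul_I :
    (fun t : ℝ => Complex.exp (t * Complex.I)).HasTemperateGrowth := by
  have hderiv (t : ℝ) : HasDerivAt (fun t : ℝ => Complex.exp (t * Complex.I))
      (Complex.I * Complex.exp (t * Complex.I)) t := by
    simpa [mul_comm] using ((Complex.ofRealCLM.hasDerivAt (x := t)).mul_const Complex.I).cexp
  have hiter (k : ℕ) : iteratedDeriv k (fun t : ℝ => Complex.exp (t * Complex.I))
      = fun t : ℝ => Complex.I ^ k * Complex.exp (t * Complex.I) := by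
    induction k with
    | zero => simp
    | succ k ih =>
      ext t
      rw [iteratedDeriv_succ, ih, ((hderiv t).const_mul _).deriv, pow_succ, mul_assoc]
  refine ⟨(Complex.ofRealCLM.contDiff.mul contDiff_const).cexp, fun k => ⟨0, 1, fun t => ?_⟩⟩
  rw [norm_iteratedFDeriv_eq_norm_iteratedDeriv, hiter]
  simp

section FourierInjectivity

variable {V : Type*} [NormedAddCommGroup V] [InnerProductSpace ℝ V] [FiniteDimensional ℝ V]
  [MeasurableSpace V] [BorelSpace V]

theorem ae_eq_zero_of_fourier_eq_zero {F : Type*} [NormedAddCommGroup F] [NormedSpace ℂ F]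
    [CompleteSpace F] {f : V → F} (hf : Integrable f) (h : 𝓕 f = 0) : f =ᵐ[volume] 0 := by
  refine ae_eq_zero_of_integral_contDiff_smul_eq_zero hf.locallyIntegrable fun g hg hgs => ?_
  let G : SchwartzMap V ℂ := (hgs.comp_left Complex.ofReal_zero).toSchwartzMap
    (Complex.ofRealCLM.contDiff.comp hg)
  have hG (x : V) : 𝓕 (⇑(𝓕⁻ G : SchwartzMap V ℂ)) x = g x := by
    rw [← SchwartzMap.fourier_coe, FourierTransform.fourier_fourierInv_eq]
    rfl
  have hflip := VectorFourier.integral_fourierIntegral_smul_eq_flip (L := innerₗ V)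
    Real.continuous_fourierChar continuous_inner
    (SchwartzMap.integrable (μ := volume) (𝓕⁻ G : SchwartzMap V ℂ)) hf
  have hf' (w : V) : VectorFourier.fourierIntegral Real.fourierChar volume (innerₗ V) f w = 0 :=
    congrFun h w
  simp only [flip_innerₗ, hf', smul_zero, integral_zero] at hflip
  rw [← hflip]
  refine integral_congr_ae (.of_forall fun x => ?_)
  beta_reduce
  rw [← Complex.coe_smul]
  exact congrArg (· • f x) (hG x).symm

theorem ae_eq_of_fourier_eq {F : Type*} [NormedAddCommGroup F] [NormedSpace ℂ F]
    [CompleteSpace F] {f g : V → F} (hf : Integrable f) (hg : Integrable g) (h : 𝓕 f = 𝓕 g) :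
    f =ᵐ[volume] g := by
  refine (ae_eq_zero_of_fourier_eq_zero (hf.sub hg) ?_).mono fun x hx => sub_eq_zero.1 hx
  ext w
  simp only [Real.fourier_eq, Pi.sub_apply, smul_sub]
  rw [integral_sub ((Real.fourierIntegral_convergent_iff w).2 hf)
    ((Real.fourierIntegral_convergent_iff w).2 hg), ← Real.fourier_eq, ← Real.fourier_eq, h,
    sub_self, Pi.zero_apply]

end FourierInjectivity

section Haar

variable {V : Type*} [NormedAddCommGroup V] [NormedSpace ℝ V] [FiniteDimensional ℝ V]
  [MeasurableSpace V] [BorelSpace V] (μ : Measure V) [μ.IsAddHaarMeasure]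

theorem map_add_smul (x : V) {c : ℝ} (hc : c ≠ 0) :
    μ.map (fun y => x + c • y) = ENNReal.ofReal |(c ^ Module.finrank ℝ V)⁻¹| • μ := by
  have hcomp : (fun y : V => x + c • y) = (x + ·) ∘ (c • ·) := rfl
  rw [hcomp, ← Measure.map_map (by fun_prop) (by fun_prop), Measure.map_addHaar_smul μ hc,
    Measure.map_smul, (measurePreserving_add_left μ x).map_eq]

theorem quasiMeasurePreserving_add_smul (x : V) {c : ℝ} (hc : c ≠ 0) :
    Measure.QuasiMeasurePreserving (fun y => x + c • y) μ μ :=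
  ⟨by fun_prop, by rw [map_add_smul μ x hc]; exact Measure.smul_absolutelyContinuous⟩

theorem quasiMeasurePreserving_sub_smul (x : V) {c : ℝ} (hc : c ≠ 0) :
    Measure.QuasiMeasurePreserving (fun y => x - c • y) μ μ := by
  simpa only [sub_eq_add_neg, neg_smul]
    using quasiMeasurePreserving_add_smul μ x (neg_ne_zero.2 hc)

variable {μ}

theorem memLp_comp_add_smul {E : Type*} [NormedAddCommGroup E] {p : ENNReal} {ψ : V → E}
    (hψ : MemLp ψ p μ) (x : V) {c : ℝ} (hc : c ≠ 0) : MemLp (fun y => ψ (x + c • y)) p μ := by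
  have hmap : MemLp ψ p (μ.map fun y => x + c • y) := by
    rw [map_add_smul μ x hc]
    exact hψ.smul_measure ENNReal.ofReal_ne_top
  exact (memLp_map_measure_iff hmap.1 (by fun_prop)).1 hmap

theorem ae_ae_of_forall_ae_add_sub {P : V → V → Prop}
    (hP : MeasurableSet {q : V × V | P q.1 q.2})
    (h : ∀ x, ∀ᵐ y ∂μ, P (x + (1 / 2 : ℝ) • y) (x - (1 / 2 : ℝ) • y)) :
    ∀ᵐ v ∂μ, ∀ᵐ u ∂μ, P u v := by
  have hreflect (x : V) : ∀ᵐ v ∂μ, P ((2 : ℝ) • x - v) v := by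
    filter_upwards [(quasiMeasurePreserving_sub_smul μ ((2 : ℝ) • x) two_ne_zero).ae (h x)]
      with v hv
    convert hv using 1 <;> module
  have hmeas : MeasurableSet {q : V × V | P ((2 : ℝ) • q.1 - q.2) q.2} :=
    hP.preimage (f := fun q : V × V => ((2 : ℝ) • q.1 - q.2, q.2)) (by fun_prop)
  have hswap : ∀ᵐ v ∂μ, ∀ᵐ x ∂μ, P ((2 : ℝ) • x - v) v :=
    (Measure.ae_ae_comm hmeas).1 (.of_forall hreflect)
  filter_upwards [hswap] with v hv
  filter_upwards [(quasiMeasurePreserving_add_smul μ ((1 / 2 : ℝ) • v) (c := 1 / 2)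
    (by norm_num)).ae hv] with u hu
  convert hu using 1
  module

end Haar

section Phase

variable {X 𝕜 : Type*} [MeasurableSpace X] {μ : Measure X} [RCLike 𝕜] {ψ φ : X → 𝕜}

theorem exists_ae_eq_mul_of_ae_mul_star_eq
    (h : ∀ᵐ v ∂μ, ∀ᵐ u ∂μ, ψ u * star (ψ v) = φ u * star (φ v)) (hφ : ¬φ =ᵐ[μ] 0) :
    ∃ c : 𝕜, ψ =ᵐ[μ] fun u => c * φ u := by
  have hφ' : ∃ᶠ v in ae μ, φ v ≠ 0 := Filter.not_eventually.1 hφ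
  obtain ⟨v, hφv, hv⟩ := (hφ'.and_eventually h).exists
  obtain ⟨u, hφu, hu⟩ := (hφ'.and_eventually hv).exists
  have hψv : star (ψ v) ≠ 0 := fun h0 => by
    rw [h0, mul_zero] at hu
    exact mul_ne_zero hφu (star_ne_zero.2 hφv) hu.symm
  refine ⟨star (φ v) / star (ψ v), hv.mono fun u hu => ?_⟩
  beta_reduce
  rw [div_mul_eq_mul_div, eq_div_iff hψv, hu, mul_comm]

theorem ae_eq_zero_of_ae_mul_star_eq_zero (h : ∀ᵐ v ∂μ, ∀ᵐ u ∂μ, ψ u * star (ψ v) = 0) :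
    ψ =ᵐ[μ] 0 := by
  by_contra hψ
  have hψ' : ∃ᶠ v in ae μ, ψ v ≠ 0 := Filter.not_eventually.1 hψ
  obtain ⟨v, hψv, hv⟩ := (hψ'.and_eventually h).exists
  exact hψ (hv.mono fun u hu => (mul_eq_zero.1 hu).resolve_right (star_ne_zero.2 hψv))

theorem exists_norm_eq_one_ae_eq_mul_of_ae_mul_star_eq
    (h : ∀ᵐ v ∂μ, ∀ᵐ u ∂μ, ψ u * star (ψ v) = φ u * star (φ v)) :
    ∃ c : 𝕜, ‖c‖ = 1 ∧ ψ =ᵐ[μ] fun u => c * φ u := by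
  by_cases hφ : φ =ᵐ[μ] 0
  · have hψ : ψ =ᵐ[μ] 0 := ae_eq_zero_of_ae_mul_star_eq_zero <| h.mono fun v hv => by
      filter_upwards [hv, hφ] with u hu hφu
      rw [hu, hφu, Pi.zero_apply, zero_mul]
    refine ⟨1, norm_one, ?_⟩
    filter_upwards [hψ, hφ] with u hψu hφu
    rw [hψu, hφu, Pi.zero_apply, mul_zero]
  obtain ⟨c, hc⟩ := exists_ae_eq_mul_of_ae_mul_star_eq h hφ
  have hφ' : ∃ᶠ v in ae μ, φ v ≠ 0 := Filter.not_eventually.1 hφ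
  obtain ⟨v, hφv, hcv, hv⟩ := (hφ'.and_eventually (hc.and h)).exists
  obtain ⟨u, hφu, hcu, hu⟩ := (hφ'.and_eventually (hc.and hv)).exists
  have hnorm : ‖c‖ ^ 2 = 1 := by
    have hne : ‖φ u‖ * ‖φ v‖ ≠ 0 := mul_ne_zero (norm_ne_zero_iff.2 hφu) (norm_ne_zero_iff.2 hφv)
    have hmul := congrArg norm hu
    rw [hcu, hcv] at hmul
    simp only [norm_mul, norm_star] at hmul
    exact mul_right_cancel₀ hne (by linear_combination hmul)
  exact ⟨c, (pow_eq_one_iff_of_nonneg (norm_nonneg c) two_ne_zero).1 hnorm, hc⟩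

end Phase

section Correlation

variable {V : Type*} [NormedAddCommGroup V] [NormedSpace ℝ V]

/-- The correlation `y ↦ ψ(x + y/2) conj(ψ(x - y/2))` of `ψ` about `x`. The Wigner transform of `ψ`
at `(x, p)` is, up to normalization, the Fourier transform of this function at `p`. -/
noncomputable def correlation (ψ : V → ℂ) (x y : V) : ℂ :=
  ψ (x + (1 / 2 : ℝ) • y) * star (ψ (x - (1 / 2 : ℝ) • y))

theorem correlation_mul (ψ φ : V → ℂ) (x y : V) :
    correlation (fun v => ψ v * φ v) x y = correlation ψ x y * correlation φ x y := by
  simp only [correlation, star_mul']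
  ring

theorem correlation_const_mul (c : ℂ) (ψ : V → ℂ) (x y : V) :
    correlation (fun v => c * ψ v) x y = ‖c‖ ^ 2 * correlation ψ x y := by
  have hc : c * star c = ‖c‖ ^ 2 := RCLike.mul_conj c
  rw [correlation_mul, ← hc]
  rfl

theorem correlation_cexp (θ : V → ℂ) (x y : V) :
    correlation (fun v => Complex.exp (θ v)) x y
      = Complex.exp (θ (x + (1 / 2 : ℝ) • y) + star (θ (x - (1 / 2 : ℝ) • y))) := by
  simp only [correlation, Complex.star_def, ← Complex.exp_conj, Complex.exp_add]

theorem correlation_cexp_ofReal_mul_I (θ : V → ℝ) (x y : V) :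
    correlation (fun v => Complex.exp (θ v * Complex.I)) x y = Complex.exp
      (((θ (x + (1 / 2 : ℝ) • y) - θ (x - (1 / 2 : ℝ) • y) : ℝ) : ℂ) * Complex.I) := by
  rw [correlation_cexp, Complex.star_def, map_mul, Complex.conj_ofReal, Complex.conj_I]
  push_cast
  ring_nf

theorem correlation_comp_sub (ψ : V → ℂ) (a x y : V) :
    correlation (fun v => ψ (v - a)) x y = correlation ψ (x - a) y := by
  simp only [correlation, add_sub_right_comm, sub_right_comm]

variable [FiniteDimensional ℝ V] [MeasurableSpace V] [BorelSpace V] {μ : Measure V}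
  [μ.IsAddHaarMeasure] {ψ φ : V → ℂ}

theorem correlation_congr_ae (h : ψ =ᵐ[μ] φ) (x : V) : correlation ψ x =ᵐ[μ] correlation φ x := by
  filter_upwards [(quasiMeasurePreserving_add_smul μ x (c := 1 / 2) (by norm_num)).ae h,
    (quasiMeasurePreserving_sub_smul μ x (c := 1 / 2) (by norm_num)).ae h] with y h1 h2
  rw [correlation, h1, h2, correlation]

theorem integrable_correlation (hψ : MemLp ψ 2 μ) (x : V) : Integrable (correlation ψ x) μ := by
  have hsub : MemLp (fun y => ψ (x - (1 / 2 : ℝ) • y)) 2 μ := by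
    simpa only [neg_smul, ← sub_eq_add_neg]
      using memLp_comp_add_smul hψ x (c := -(1 / 2)) (by norm_num)
  exact (memLp_comp_add_smul hψ x (by norm_num)).integrable_mul hsub.star

end Correlation

/-! ### Symplectic matrices -/

section Blocks

variable {l R : Type*} [Fintype l] [DecidableEq l] [CommRing R] {a b c d : Matrix l l R}

/-- The symplectic matrix `(x, p) ↦ (p, -x)`, which is the inverse of `Matrix.J`. -/
def quarterTurn (l R : Type*) [Fintype l] [DecidableEq l] [CommRing R] : symplecticGroup l R :=
  ⟨fromBlocks 0 1 (-1) 0, by simp [SymplecticGroup.fromBlocks_mem_iff]⟩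

/-- The symplectic shear `(x, p) ↦ (x, Px + p)`. -/
def lowerShear (P : Matrix l l R) (hP : P.IsSymm) : symplecticGroup l R :=
  ⟨fromBlocks 1 0 P 1, by simp [SymplecticGroup.fromBlocks_mem_iff, hP.eq]⟩

/-- The symplectic shear `(x, p) ↦ (x + Pp, p)`. -/
def upperShear (P : Matrix l l R) (hP : P.IsSymm) : symplecticGroup l R :=
  ⟨fromBlocks 1 P 0 1, by simp [SymplecticGroup.fromBlocks_mem_iff, hP.eq]⟩

/-- The symplectic matrix `(x, p) ↦ (L⁻¹x, Lᵀp)`. -/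
noncomputable def blockDiagonal (L : GL l R) : symplecticGroup l R :=
  ⟨fromBlocks (L : Matrix l l R)⁻¹ 0 0 (L : Matrix l l R)ᵀ, by
    simp [SymplecticGroup.fromBlocks_mem_iff, ← Matrix.transpose_mul,
      Matrix.mul_nonsing_inv _ (Matrix.isUnits_det_units L)]⟩

theorem upperShear_eq_quarterTurn_mul_lowerShear_mul_inv {P : Matrix l l R} (hP : P.IsSymm) :
    upperShear P hP = quarterTurn l R * lowerShear (-P) hP.neg * (quarterTurn l R)⁻¹ := by
  rw [eq_mul_inv_iff_mul_eq]
  ext1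
  simp [upperShear, lowerShear, quarterTurn, Matrix.fromBlocks_multiply]

theorem isSymm_mul_nonsing_inv (ha : IsUnit a.det) (h : aᵀ * c = cᵀ * a) :
    (c * a⁻¹).IsSymm := by
  have ha' : IsUnit aᵀ.det := by rwa [Matrix.det_transpose]
  calc (c * a⁻¹)ᵀ = aᵀ⁻¹ * (cᵀ * a) * a⁻¹ := by
        rw [Matrix.transpose_mul, Matrix.transpose_nonsing_inv, ← Matrix.mul_assoc,
          Matrix.mul_nonsing_inv_cancel_right _ _ ha]
    _ = c * a⁻¹ := by rw [← h, Matrix.nonsing_inv_mul_cancel_left _ _ ha']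

theorem isSymm_nonsing_inv_mul (ha : IsUnit a.det) (h : a * bᵀ = b * aᵀ) :
    (a⁻¹ * b).IsSymm := by
  have hsymm : (bᵀ * aᵀ⁻¹).IsSymm :=
    isSymm_mul_nonsing_inv (by rwa [Matrix.det_transpose]) (by simpa only [transpose_transpose])
  simpa only [Matrix.transpose_mul, Matrix.transpose_nonsing_inv, transpose_transpose]
    using hsymm.transpose

theorem fromBlocks_mem_symplecticGroup_iff' :
    fromBlocks a b c d ∈ symplecticGroup l R ↔
      a * bᵀ = b * aᵀ ∧ c * dᵀ = d * cᵀ ∧ a * dᵀ - b * cᵀ = 1 := by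
  rw [← SymplecticGroup.transpose_mem_iff, Matrix.fromBlocks_transpose,
    SymplecticGroup.fromBlocks_mem_iff]
  simp only [transpose_transpose]

theorem fromBlocks_eq_shear_mul_diagonal_mul_shear (h : fromBlocks a b c d ∈ symplecticGroup l R)
    (ha : IsUnit a.det) :
    fromBlocks a b c d
      = fromBlocks 1 0 (c * a⁻¹) 1 * fromBlocks a 0 0 aᵀ⁻¹ * fromBlocks 1 (a⁻¹ * b) 0 1 := by
  obtain ⟨hac, -, had⟩ := SymplecticGroup.fromBlocks_mem_iff.1 h
  have ha' : IsUnit aᵀ.det := by rwa [Matrix.det_transpose]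
  have hd : d - c * a⁻¹ * b = aᵀ⁻¹ := by
    rw [← (isSymm_mul_nonsing_inv ha hac).eq, Matrix.transpose_mul, Matrix.transpose_nonsing_inv]
    calc d - aᵀ⁻¹ * cᵀ * b = aᵀ⁻¹ * (aᵀ * d - cᵀ * b) := by
          rw [Matrix.mul_sub, Matrix.nonsing_inv_mul_cancel_left _ _ ha', Matrix.mul_assoc]
      _ = aᵀ⁻¹ := by rw [had, Matrix.mul_one]
  let := Matrix.invertibleOfIsUnitDet a ha
  rw [Matrix.fromBlocks_eq_of_invertible₁₁, Matrix.invOf_eq_nonsing_inv, hd]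

theorem mem_of_isUnit_det_toBlocks₁₁ {H : Subgroup (symplecticGroup l R)}
    (hlower : ∀ P hP, lowerShear P hP ∈ H) (hupper : ∀ P hP, upperShear P hP ∈ H)
    (hdiag : ∀ L, blockDiagonal L ∈ H) (S : symplecticGroup l R)
    (hS : IsUnit (S : Matrix (l ⊕ l) (l ⊕ l) R).toBlocks₁₁.det) : S ∈ H := by
  obtain ⟨S, hmem⟩ := S
  obtain ⟨a, b, c, d, rfl⟩ : ∃ a b c d, S = fromBlocks a b c d :=
    ⟨_, _, _, _, (Matrix.fromBlocks_toBlocks S).symm⟩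
  rw [Matrix.toBlocks_fromBlocks₁₁] at hS
  have hP := isSymm_mul_nonsing_inv hS (SymplecticGroup.fromBlocks_mem_iff.1 hmem).1
  have hQ := isSymm_nonsing_inv_mul hS (fromBlocks_mem_symplecticGroup_iff'.1 hmem).1
  let L : GL l R := (Matrix.nonsingInvUnit a hS)⁻¹
  have hL : (L : Matrix l l R) = a⁻¹ := rfl
  have hprod : (⟨_, hmem⟩ : symplecticGroup l R)
      = lowerShear _ hP * blockDiagonal L * upperShear _ hQ := by
    ext1
    simp only [lowerShear, blockDiagonal, upperShear, hL, Submonoid.coe_mul,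
      Matrix.nonsing_inv_nonsing_inv _ hS, Matrix.transpose_nonsing_inv]
    exact fromBlocks_eq_shear_mul_diagonal_mul_shear hmem hS
  rw [hprod]
  exact mul_mem (mul_mem (hlower _ hP) (hdiag L)) (hupper _ hQ)

end Blocks

theorem exists_det_add_smul_ne_zero {ι K L : Type*} [Fintype ι] [DecidableEq ι] [CommRing K]
    [IsDomain K] [Infinite K] [CommRing L] [Algebra K L] {a c : Matrix ι ι K} {z : L}
    (h : (a.map (algebraMap K L) + z • c.map (algebraMap K L)).det ≠ 0) :
    ∃ s : K, (a + s • c).det ≠ 0 := by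
  let p : Polynomial K := (a.map Polynomial.C + (Polynomial.X : Polynomial K) •
    c.map Polynomial.C).det
  have heval (s : K) : p.eval s = (a + s • c).det := by
    rw [← Polynomial.coe_evalRingHom, RingHom.map_det]
    congr 1
    ext i j
    simp [mul_comm (c i j)]
  have haeval : Polynomial.aeval z p
      = (a.map (algebraMap K L) + z • c.map (algebraMap K L)).det := by
    rw [AlgHom.map_det]
    congr 1
    ext i j
    simp [mul_comm z]
  have hp : p ≠ 0 := fun h0 => h (by rw [← haeval, h0, map_zero])
  by_contra! hdet
  exact hp (Polynomial.funext fun s => by rw [heval, hdet, Polynomial.eval_zero])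

theorem posDef_mul_transpose_self {m : Type*} [Fintype m] [DecidableEq m] {M : Matrix m m ℝ}
    (hM : IsUnit M.det) : (M * Mᵀ).PosDef := by
  rw [← Matrix.conjTranspose_eq_transpose_of_trivial]
  exact Matrix.PosDef.mul_conjTranspose_self M
    (Matrix.vecMul_injective_iff_isUnit.2 ((Matrix.isUnit_iff_isUnit_det M).2 hM))

theorem posDef_toBlocks₁₁ {m l : Type*} {M : Matrix (m ⊕ l) (m ⊕ l) ℝ}
    (hM : M.PosDef) : M.toBlocks₁₁.PosDef :=
  hM.submatrix Sum.inl_injective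

section Real

variable {l : Type*} [Fintype l] [DecidableEq l]

theorem det_add_I_smul_ne_zero {a c : Matrix l l ℝ} (hac : aᵀ * c = cᵀ * a)
    (hdet : (aᵀ * a + cᵀ * c).det ≠ 0) :
    (a.map (algebraMap ℝ ℂ) + Complex.I • c.map (algebraMap ℝ ℂ)).det ≠ 0 := by
  have hmul : (aᵀ.map (algebraMap ℝ ℂ) - Complex.I • cᵀ.map (algebraMap ℝ ℂ))
      * (a.map (algebraMap ℝ ℂ) + Complex.I • c.map (algebraMap ℝ ℂ))
      = (aᵀ * a + cᵀ * c).map (algebraMap ℝ ℂ) := by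
    have hac' : aᵀ.map (algebraMap ℝ ℂ) * c.map (algebraMap ℝ ℂ)
        = cᵀ.map (algebraMap ℝ ℂ) * a.map (algebraMap ℝ ℂ) := by
      rw [← Matrix.map_mul, hac, Matrix.map_mul]
    rw [Matrix.map_add _ (map_add _), Matrix.map_mul, Matrix.map_mul, sub_mul, mul_add, mul_add,
      Matrix.mul_smul, Matrix.smul_mul, Matrix.smul_mul, Matrix.mul_smul, hac', smul_smul,
      Complex.I_mul_I, neg_one_smul]
    abel
  intro h0
  have hdet' := congrArg Matrix.det hmul
  rw [Matrix.det_mul, h0, mul_zero, ← RingHom.mapMatrix_apply, ← RingHom.map_det] at hdet'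
  exact hdet (Complex.ofReal_eq_zero.1 hdet'.symm)

theorem exists_isUnit_det_add_smul {a b c d : Matrix l l ℝ}
    (h : fromBlocks a b c d ∈ symplecticGroup l ℝ) : ∃ s : ℝ, IsUnit (a + s • c).det := by
  have hpos : (aᵀ * a + cᵀ * c).PosDef := by
    have hmul := posDef_toBlocks₁₁ <| posDef_mul_transpose_self <|
      SymplecticGroup.symplectic_det (SymplecticGroup.transpose_mem h)
    rwa [transpose_transpose, Matrix.fromBlocks_transpose, Matrix.fromBlocks_multiply,
      Matrix.toBlocks_fromBlocks₁₁] at hmul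
  obtain ⟨s, hs⟩ := exists_det_add_smul_ne_zero <|
    det_add_I_smul_ne_zero (SymplecticGroup.fromBlocks_mem_iff.1 h).1 hpos.det_pos.ne'
  exact ⟨s, hs.isUnit⟩

theorem symplecticGroup_subgroup_eq_top {H : Subgroup (symplecticGroup l ℝ)}
    (hturn : quarterTurn l ℝ ∈ H) (hlower : ∀ P hP, lowerShear P hP ∈ H)
    (hdiag : ∀ L, blockDiagonal L ∈ H) : H = ⊤ := by
  have hupper (P : Matrix l l ℝ) (hP : P.IsSymm) : upperShear P hP ∈ H := by
    rw [upperShear_eq_quarterTurn_mul_lowerShear_mul_inv]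
    exact mul_mem (mul_mem hturn (hlower _ _)) (inv_mem hturn)
  refine eq_top_iff.2 fun S _ => ?_
  obtain ⟨S, hS⟩ := S
  obtain ⟨a, b, c, d, rfl⟩ : ∃ a b c d, S = fromBlocks a b c d :=
    ⟨_, _, _, _, (Matrix.fromBlocks_toBlocks S).symm⟩
  obtain ⟨s, hs⟩ := exists_isUnit_det_add_smul hS
  have hsymm : (s • (1 : Matrix l l ℝ)).IsSymm := Matrix.isSymm_one.smul s
  refine (H.mul_mem_cancel_left (hupper _ hsymm)).1 <|
    mem_of_isUnit_det_toBlocks₁₁ hlower hupper hdiag _ ?_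
  simpa [upperShear, Matrix.fromBlocks_multiply] using hs

theorem exists_shear_mul_diagonal_eq_mul_transpose {S : Matrix (l ⊕ l) (l ⊕ l) ℝ}
    (hS : S ∈ symplecticGroup l ℝ) : ∃ A B : Matrix l l ℝ, A.PosDef ∧ B.IsSymm ∧
      S * Sᵀ = fromBlocks 1 0 (-B) 1 * fromBlocks A⁻¹ 0 0 A * (fromBlocks 1 0 (-B) 1)ᵀ := by
  have hpos := posDef_mul_transpose_self (SymplecticGroup.symplectic_det hS)
  have hmem := mul_mem hS (SymplecticGroup.transpose_mem hS)
  have hsymm : (S * Sᵀ).IsSymm := Matrix.isSymm_mul_transpose_self S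
  obtain ⟨a, b, c, d, hN⟩ : ∃ a b c d, S * Sᵀ = fromBlocks a b c d :=
    ⟨_, _, _, _, (Matrix.fromBlocks_toBlocks _).symm⟩
  rw [hN] at hpos hmem hsymm ⊢
  have ha : a.PosDef := posDef_toBlocks₁₁ hpos
  have hunit : IsUnit a.det := ha.det_pos.ne'.isUnit
  obtain ⟨haa, hbc, -, -⟩ := Matrix.isSymm_fromBlocks_iff.1 hsymm
  have hB := isSymm_mul_nonsing_inv hunit (SymplecticGroup.fromBlocks_mem_iff.1 hmem).1
  refine ⟨a⁻¹, -(c * a⁻¹), ha.inv, hB.neg, ?_⟩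
  have hab : a⁻¹ * b = (c * a⁻¹)ᵀ := by
    rw [Matrix.transpose_mul, Matrix.transpose_nonsing_inv, haa, ← hbc, transpose_transpose]
  rw [fromBlocks_eq_shear_mul_diagonal_mul_shear hmem hunit, hab,
    Matrix.nonsing_inv_nonsing_inv _ hunit, haa, neg_neg, Matrix.fromBlocks_transpose]
  simp only [Matrix.transpose_one, Matrix.transpose_zero]

end Real

/-! ### Linear maps of Euclidean and phase spaces -/

section Lin

variable {ι : Type*} [Fintype ι] (M : Matrix ι ι ℝ) (v w : EuclideanSpace ℝ ι)

@[simp]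
theorem lin_zero_left : lin 0 v = 0 := by
  simp [lin]

@[simp]
theorem lin_neg_left : lin (-M) v = -lin M v := by
  simp [lin, Matrix.neg_mulVec]

theorem lin_sub : lin M (v - w) = lin M v - lin M w := by
  simp [lin, Matrix.mulVec_sub]

theorem lin_neg : lin M (-v) = -lin M v := by
  simp [lin, Matrix.mulVec_neg]

theorem lin_smul (c : ℝ) : lin M (c • v) = c • lin M v := by
  simp [lin, Matrix.mulVec_smul]

theorem inner_lin_left : inner ℝ (lin M v) w = (inner ℝ v (lin Mᵀ w) : ℝ) := by
  simp only [lin, EuclideanSpace.inner_eq_star_dotProduct, star_trivial]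
  rw [Matrix.dotProduct_mulVec, Matrix.mulVec_transpose]

theorem quad_eq_inner_lin : quad M v = inner ℝ (lin M v) v := by
  simp [quad, lin, EuclideanSpace.inner_eq_star_dotProduct, dotProduct_comm]

variable {M}

theorem quad_add_sub_quad_sub (hM : M.IsSymm) :
    quad M (v + w) - quad M (v - w) = 4 * inner ℝ (lin M v) w := by
  have hsymm : inner ℝ (lin M w) v = (inner ℝ (lin M v) w : ℝ) := by
    rw [inner_lin_left, hM.eq, real_inner_comm]
  simp only [quad_eq_inner_lin, lin_add, lin_sub, inner_add_left, inner_add_right, inner_sub_left,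
    inner_sub_right, hsymm]
  ring

variable {n : ℕ}

theorem pos_lin_fromBlocks (a b c d : Matrix (Fin n) (Fin n) ℝ) (z : Phase n) :
    pos (lin (fromBlocks a b c d) z) = lin a (pos z) + lin b (mom z) := by
  ext i
  exact congrFun (Matrix.fromBlocks_mulVec a b c d z.ofLp) (Sum.inl i)

theorem mom_lin_fromBlocks (a b c d : Matrix (Fin n) (Fin n) ℝ) (z : Phase n) :
    mom (lin (fromBlocks a b c d) z) = lin c (pos z) + lin d (mom z) := by
  ext i
  exact congrFun (Matrix.fromBlocks_mulVec a b c d z.ofLp) (Sum.inr i)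

theorem norm_sq_eq_pos_add_mom (z : Phase n) : ‖z‖ ^ 2 = ‖pos z‖ ^ 2 + ‖mom z‖ ^ 2 := by
  simp [EuclideanSpace.real_norm_sq_eq, pos, mom]

theorem integral_comp_lin {E : Type*} [NormedAddCommGroup E] [NormedSpace ℝ E]
    (L : GL (Fin n) ℝ) (g : Config n → E) :
    ∫ y, g (lin (L : Matrix (Fin n) (Fin n) ℝ) y)
      = |(L : Matrix (Fin n) (Fin n) ℝ).det|⁻¹ • ∫ y, g y := by
  have hmap := (linEquiv L).measurableEmbedding.integral_map (μ := volume) g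
  rw [map_linEquiv, integral_smul_measure, ENNReal.toReal_ofReal (by positivity)] at hmap
  exact hmap.symm

end Lin

variable {n : ℕ} {ħ : ℝ}

/-! ### The Wigner transform of a function -/

section Wigner

variable {ψ φ : Config n → ℂ} {z w : Phase n}

theorem wigner_eq_integral_correlation (ħ : ℝ) (ψ : Config n → ℂ) (z : Phase n) :
    wigner ħ ψ z = (1 / (2 * Real.pi * ħ)) ^ n * ∫ y : Config n,
      Complex.exp (-(Complex.I / ħ) * (inner ℝ (mom z) y : ℝ)) * correlation ψ (pos z) y := by
  simp only [wigner, correlation, mul_assoc]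

theorem wigner_congr_ae (h : ψ =ᵐ[volume] φ) (z : Phase n) : wigner ħ ψ z = wigner ħ φ z := by
  rw [wigner_eq_integral_correlation, wigner_eq_integral_correlation]
  congr 1
  refine integral_congr_ae ?_
  filter_upwards [correlation_congr_ae h (pos z)] with y hy
  rw [hy]

theorem wigner_const_mul (c : ℂ) : wigner ħ (fun x => c * ψ x) z = ‖c‖ ^ 2 * wigner ħ ψ z := by
  simp only [wigner_eq_integral_correlation, correlation_const_mul, mul_left_comm _ ((‖c‖ : ℂ) ^ 2),
    integral_const_mul]

theorem wigner_eq_of_correlation_eq (h : ∀ y, correlation φ (pos w) y = Complex.exp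
      (((1 / ħ * inner ℝ (mom w - mom z) y : ℝ) : ℂ) * Complex.I) * correlation ψ (pos z) y) :
    wigner ħ φ w = wigner ħ ψ z := by
  rw [wigner_eq_integral_correlation, wigner_eq_integral_correlation]
  congr 2
  ext y
  rw [h, ← mul_assoc, ← Complex.exp_add]
  congr 2
  rw [inner_sub_left]
  push_cast
  ring

theorem correlation_comp_lin (M : Matrix (Fin n) (Fin n) ℝ) (ψ : Config n → ℂ) (x y : Config n) :
    correlation (fun v => ψ (lin M v)) x y = correlation ψ (lin M x) (lin M y) := by
  simp only [correlation, lin_add, lin_sub, lin_smul]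

theorem wigner_const_mul_comp_lin {c : ℂ} {L : GL (Fin n) ℝ}
    (hc : ‖c‖ ^ 2 = |(L : Matrix (Fin n) (Fin n) ℝ).det|) :
    wigner ħ (fun x => c * ψ (lin (L : Matrix (Fin n) (Fin n) ℝ) x)) (spMap n (blockDiagonal L) z)
      = wigner ħ ψ z := by
  have hdet : |(L : Matrix (Fin n) (Fin n) ℝ).det| ≠ 0 :=
    abs_ne_zero.2 (Matrix.isUnits_det_units L).ne_zero
  have hpos : pos (spMap n (blockDiagonal L) z) = lin (L : Matrix (Fin n) (Fin n) ℝ)⁻¹ (pos z) :=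
    (pos_lin_fromBlocks ..).trans (by rw [lin_zero_left, add_zero])
  have hmom : mom (spMap n (blockDiagonal L) z) = lin (L : Matrix (Fin n) (Fin n) ℝ)ᵀ (mom z) :=
    (mom_lin_fromBlocks ..).trans (by rw [lin_zero_left, zero_add])
  have hinner (y : Config n) : inner ℝ (mom (spMap n (blockDiagonal L) z)) y
      = (inner ℝ (mom z) (lin (L : Matrix (Fin n) (Fin n) ℝ) y) : ℝ) := by
    rw [hmom, inner_lin_left, transpose_transpose]
  have hcorr (y : Config n) :
      correlation (fun x => ψ (lin (L : Matrix (Fin n) (Fin n) ℝ) x))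
        (pos (spMap n (blockDiagonal L) z)) y
      = correlation ψ (pos z) (lin (L : Matrix (Fin n) (Fin n) ℝ) y) := by
    rw [hpos, correlation_comp_lin, ← lin_mul,
      Matrix.mul_nonsing_inv _ (Matrix.isUnits_det_units L), lin_one]
  rw [wigner_const_mul, wigner_eq_integral_correlation, wigner_eq_integral_correlation]
  simp only [hinner, hcorr]
  rw [integral_comp_lin L fun y => Complex.exp (-(Complex.I / ħ) * (inner ℝ (mom z) y : ℝ)) *
    correlation ψ (pos z) y, mul_left_comm, Complex.real_smul, ← mul_assoc ((‖c‖ : ℂ) ^ 2),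
    ← Complex.ofReal_pow, hc, ← Complex.ofReal_mul, mul_inv_cancel₀ hdet, Complex.ofReal_one,
    one_mul]

end Wigner

/-! ### Symplectic covariance of the Wigner transform -/

/-- `U` covers the phase space transformation `f` if the Wigner transform of `U ψ` is that of `ψ`,
transported by `f`. The natural projections send an operator to the transformation it covers. -/
def WignerCovariant (ħ : ℝ) (U : UnitaryOp n) (f : Equiv.Perm (Phase n)) : Prop :=
  ∀ (ψ : L2 n) (z : Phase n), wigner ħ (U ψ) (f z) = wigner ħ ψ z

namespace WignerCovariant

variable {U V : UnitaryOp n} {f g : Equiv.Perm (Phase n)}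

theorem one (ħ : ℝ) : WignerCovariant ħ (1 : UnitaryOp n) 1 := fun _ _ => rfl

theorem mul (hU : WignerCovariant ħ U f) (hV : WignerCovariant ħ V g) :
    WignerCovariant ħ (U * V) (f * g) := fun ψ z =>
  (hU (V ψ) (g z)).trans (hV ψ z)

theorem inv (hU : WignerCovariant ħ U f) : WignerCovariant ħ U⁻¹ f⁻¹ := fun ψ z => by
  have hcov := hU (U⁻¹ ψ) (f⁻¹ z)
  rw [show f (f⁻¹ z) = z from f.apply_symm_apply z,
    show U (U⁻¹ ψ) = ψ from U.apply_symm_apply ψ] at hcov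
  exact hcov.symm

end WignerCovariant

theorem wignerCovariant_heisenberg (ħ : ℝ) (z₀ : Phase n) :
    WignerCovariant ħ (heisenberg ħ z₀) (translation z₀) := by
  intro ψ z
  have hpos : pos (translation z₀ z) = pos z + pos z₀ := rfl
  have hmom : mom (translation z₀ z) - mom z = mom z₀ := add_sub_cancel_left (mom z) (mom z₀)
  rw [wigner_congr_ae (heisenberg_apply ħ z₀ ψ)]
  refine wigner_eq_of_correlation_eq fun y => ?_
  rw [hpos, hmom, correlation_mul, correlation_cexp_ofReal_mul_I,
    correlation_comp_sub (ψ := ψ), add_sub_cancel_right]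
  congr 4
  simp only [inner_add_right, inner_sub_right, real_inner_smul_right]
  ring

theorem wignerCovariant_opV (ħ : ℝ) {P : Matrix (Fin n) (Fin n) ℝ} (hP : P.IsSymm) :
    WignerCovariant ħ (opV ħ P) (spMap n (lowerShear (-P) hP.neg)) := by
  intro ψ z
  have hpos : pos (spMap n (lowerShear (-P) hP.neg) z) = pos z :=
    (pos_lin_fromBlocks ..).trans (by rw [lin_one, lin_zero_left, add_zero])
  have hmom : mom (spMap n (lowerShear (-P) hP.neg) z) - mom z = -lin P (pos z) := by
    refine sub_eq_of_eq_add ((mom_lin_fromBlocks ..).trans ?_)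
    rw [lin_one, lin_neg_left]
  rw [wigner_congr_ae (opV_apply ħ P ψ)]
  refine wigner_eq_of_correlation_eq fun y => ?_
  rw [hpos, hmom, correlation_mul, correlation_cexp_ofReal_mul_I, ← mul_sub,
    quad_add_sub_quad_sub _ _ hP, real_inner_smul_right, inner_neg_left]
  congr 4
  ring

theorem wignerCovariant_scaledComp (ħ : ℝ) {c : ℂ} {L : GL (Fin n) ℝ}
    (hc : ‖c‖ ^ 2 = |(L : Matrix (Fin n) (Fin n) ℝ).det|) :
    WignerCovariant ħ (scaledComp c L hc) (spMap n (blockDiagonal L)) := fun ψ z => by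
  rw [wigner_congr_ae (scaledComp_apply c L hc ψ), wigner_const_mul_comp_lin hc]

theorem wignerCovariant_opM (ħ : ℝ) (L : GL (Fin n) ℝ) (m : ℤ) :
    WignerCovariant ħ (opM L m) (spMap n (blockDiagonal L)) :=
  wignerCovariant_scaledComp ħ _

/-! ### The Fourier transform and the quarter turn -/

/-- The parity operator `ψ ↦ ψ(-·)`, whose matrix coefficients give the Wigner transform at the
origin. -/
noncomputable def parity (n : ℕ) : UnitaryOp n :=
  scaledComp 1 (-1 : GL (Fin n) ℝ) (by simp [Matrix.det_neg])

theorem parity_apply (ψ : L2 n) : parity n ψ =ᵐ[volume] fun x => ψ (-x) := by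
  refine (scaledComp_apply 1 (-1 : GL (Fin n) ℝ) _ ψ).trans (.of_forall fun x => ?_)
  beta_reduce
  rw [one_mul, Units.val_neg, Units.val_one, lin_neg_left, lin_one]

theorem wigner_zero (ħ : ℝ) (ψ : L2 n) :
    wigner ħ ψ 0 = (1 / (2 * Real.pi * ħ)) ^ n * (2 ^ n * inner ℂ (parity n ψ) ψ) := by
  have hinner : inner ℂ (parity n ψ) ψ = ∫ y : Config n, ψ y * star (ψ (-y)) := by
    rw [L2.inner_def]
    refine integral_congr_ae ?_
    filter_upwards [parity_apply ψ] with y hy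
    rw [hy, RCLike.inner_apply]
    rfl
  have hcorr (y : Config n) : correlation ψ (pos 0) y
      = ψ ((1 / 2 : ℝ) • y) * star (ψ (-((1 / 2 : ℝ) • y))) := by
    rw [correlation, show pos (0 : Phase n) = 0 from rfl, zero_add, zero_sub]
  rw [wigner_eq_integral_correlation, show mom (0 : Phase n) = 0 from rfl]
  simp only [inner_zero_left, Complex.ofReal_zero, mul_zero, Complex.exp_zero, one_mul, hcorr]
  rw [hinner, Measure.integral_comp_smul volume fun y => ψ y * star (ψ (-y))]
  simp

theorem wigner_eq_wigner_heisenberg_zero (ħ : ℝ) (ψ : L2 n) (z : Phase n) :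
    wigner ħ ψ z = wigner ħ (heisenberg ħ (-z) ψ) 0 := by
  rw [← wignerCovariant_heisenberg ħ (-z) ψ z]
  exact congrArg _ (add_neg_cancel z)

/-- By the Grossmann–Royer formula, `Wψ(z)` is a multiple of `⟪Π T̂(-z) ψ, T̂(-z) ψ⟫`, where `Π` is
the parity operator. -/
theorem wignerCovariant_of_parity_of_heisenberg {U : UnitaryOp n} {f : Equiv.Perm (Phase n)}
    (hf : ∀ z, f (-z) = -f z) (hparity : parity n * U = U * parity n)
    (hdisp : ∀ z, heisenberg ħ (f z) * U = U * heisenberg ħ z) : WignerCovariant ħ U f := by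
  intro ψ z
  have hdisp' : heisenberg ħ (-f z) (U ψ) = U (heisenberg ħ (-z) ψ) := by
    rw [← hf]
    exact DFunLike.congr_fun (hdisp (-z)) ψ
  have hparity' (φ : L2 n) : parity n (U φ) = U (parity n φ) := DFunLike.congr_fun hparity φ
  rw [wigner_eq_wigner_heisenberg_zero, wigner_eq_wigner_heisenberg_zero ħ ψ, hdisp', wigner_zero,
    wigner_zero, hparity', U.inner_map_map]

theorem unitaryOp_mul_apply (U V : UnitaryOp n) (ψ : L2 n) : (U * V) ψ = U (V ψ) := rfl

theorem unitaryOp_ext_schwartz {U V : UnitaryOp n}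
    (h : ∀ f : SchwartzMap (Config n) ℂ, U (f.toLp 2) = V (f.toLp 2)) : U = V := by
  have hdense : DenseRange (SchwartzMap.toLpCLM ℂ ℂ 2 (volume : Measure (Config n))) :=
    SchwartzMap.denseRange_toLpCLM ENNReal.ofNat_ne_top
  ext1 ψ
  exact congrFun (hdense.equalizer U.continuous V.continuous (funext h)) ψ

/-- The operator `T̂(z₀)` on Schwartz functions. -/
noncomputable def schwartzDisplacement (ħ : ℝ) (z₀ : Phase n) (f : SchwartzMap (Config n) ℂ) :
    SchwartzMap (Config n) ℂ :=
  SchwartzMap.smulLeftCLM ℂ (fun x : Config n => Complex.exp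
      (((1 / ħ * (inner ℝ (mom z₀) x - 1 / 2 * inner ℝ (mom z₀) (pos z₀)) : ℝ) : ℂ) * Complex.I))
    (SchwartzMap.compSubConstCLM ℂ (pos z₀) f)

theorem schwartzDisplacement_apply (ħ : ℝ) (z₀ : Phase n) (f : SchwartzMap (Config n) ℂ)
    (x : Config n) :
    schwartzDisplacement ħ z₀ f x = Complex.exp
      (((1 / ħ * (inner ℝ (mom z₀) x - 1 / 2 * inner ℝ (mom z₀) (pos z₀)) : ℝ) : ℂ) * Complex.I)
        * f (x - pos z₀) := by
  refine (SchwartzMap.smulLeftCLM_apply_apply ?_ _ x).trans rfl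
  exact hasTemperateGrowth_cexp_ofReal_mul_I.comp (f := fun x : Config n =>
    1 / ħ * (inner ℝ (mom z₀) x - 1 / 2 * inner ℝ (mom z₀) (pos z₀)))
    ((Function.HasTemperateGrowth.const _).mul
      ((Function.hasTemperateGrowth_inner_right (mom z₀)).sub
        (Function.HasTemperateGrowth.const _)))

theorem heisenberg_toLp (ħ : ℝ) (z₀ : Phase n) (f : SchwartzMap (Config n) ℂ) :
    heisenberg ħ z₀ (f.toLp 2) = (schwartzDisplacement ħ z₀ f).toLp 2 := by
  ext1
  filter_upwards [heisenberg_apply ħ z₀ (f.toLp 2),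
    SchwartzMap.coeFn_toLp (schwartzDisplacement ħ z₀ f) 2 volume,
    (measurePreserving_sub_right volume (pos z₀)).quasiMeasurePreserving.ae
      (SchwartzMap.coeFn_toLp f 2 volume)] with x hheis hdisp hf
  rw [hheis, hdisp, hf, schwartzDisplacement_apply]

/-- The parity operator on Schwartz functions. -/
noncomputable def schwartzReflection (f : SchwartzMap (Config n) ℂ) : SchwartzMap (Config n) ℂ :=
  SchwartzMap.compCLMOfContinuousLinearEquiv ℂ (ContinuousLinearEquiv.neg ℝ) f

theorem schwartzReflection_apply (f : SchwartzMap (Config n) ℂ) (x : Config n) :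
    schwartzReflection f x = f (-x) := rfl

theorem parity_toLp (f : SchwartzMap (Config n) ℂ) :
    parity n (f.toLp 2) = (schwartzReflection f).toLp 2 := by
  ext1
  filter_upwards [parity_apply (f.toLp 2),
    SchwartzMap.coeFn_toLp (schwartzReflection f) 2 volume,
    (Measure.measurePreserving_neg volume).quasiMeasurePreserving.ae
      (SchwartzMap.coeFn_toLp f 2 volume)] with x hparity hrefl hf
  rw [hparity, hrefl, hf, schwartzReflection_apply]

theorem parity_mul_opJ (hħ : 0 < ħ) : parity n * opJ n hħ = opJ n hħ * parity n := by
  refine unitaryOp_ext_schwartz fun f => ?_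
  rw [unitaryOp_mul_apply, unitaryOp_mul_apply, parity_toLp]
  ext1
  filter_upwards [parity_apply (opJ n hħ (f.toLp 2)), opJ_apply hħ (schwartzReflection f),
    (Measure.measurePreserving_neg volume).quasiMeasurePreserving.ae (opJ_apply hħ f)]
    with x hparity hrefl hf
  rw [hparity, hrefl, hf, ← integral_neg_eq_self]
  simp only [inner_neg_left, inner_neg_right, neg_neg, schwartzReflection_apply]

theorem heisenberg_mul_opJ (hħ : 0 < ħ) (z : Phase n) :
    heisenberg ħ (spMap n (quarterTurn (Fin n) ℝ) z) * opJ n hħ = opJ n hħ * heisenberg ħ z := by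
  have hpos : pos (spMap n (quarterTurn (Fin n) ℝ) z) = mom z :=
    (pos_lin_fromBlocks ..).trans (by rw [lin_zero_left, lin_one, zero_add])
  have hmom : mom (spMap n (quarterTurn (Fin n) ℝ) z) = -pos z :=
    (mom_lin_fromBlocks ..).trans (by rw [lin_zero_left, lin_neg_left, lin_one, add_zero])
  refine unitaryOp_ext_schwartz fun f => ?_
  rw [unitaryOp_mul_apply, unitaryOp_mul_apply, heisenberg_toLp]
  ext1
  have hheis := heisenberg_apply ħ (spMap n (quarterTurn (Fin n) ℝ) z) (opJ n hħ (f.toLp 2))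
  rw [hpos, hmom] at hheis
  filter_upwards [hheis, opJ_apply hħ (schwartzDisplacement ħ z f),
    (measurePreserving_sub_right volume (mom z)).quasiMeasurePreserving.ae (opJ_apply hħ f)]
    with x hheis hdisp hf
  rw [hheis, hdisp, hf, mul_left_comm, ← integral_const_mul,
    ← integral_sub_right_eq_self _ (pos z)]
  congr 2
  ext u
  rw [schwartzDisplacement_apply, ← mul_assoc, ← mul_assoc, ← Complex.exp_add, ← Complex.exp_add]
  congr 2
  simp only [inner_sub_right, inner_sub_left, inner_neg_right, real_inner_comm (mom z),
    real_inner_comm x]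
  push_cast
  ring

theorem wignerCovariant_opJ (hħ : 0 < ħ) :
    WignerCovariant ħ (opJ n hħ) (spMap n (quarterTurn (Fin n) ℝ)) :=
  wignerCovariant_of_parity_of_heisenberg (fun z => lin_neg _ z) (parity_mul_opJ hħ)
    (heisenberg_mul_opJ hħ)

/-! ### Recovering a function from its Wigner transform -/

section Uniqueness

theorem exists_pos_eq_mom_eq (x p : Config n) : ∃ z : Phase n, pos z = x ∧ mom z = p :=
  ⟨WithLp.toLp 2 (Sum.elim x p), rfl, rfl⟩

theorem wigner_eq_fourier_correlation (hħ : ħ ≠ 0) (ψ : Config n → ℂ) (z : Phase n) :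
    wigner ħ ψ z = (1 / (2 * Real.pi * ħ)) ^ n
      * 𝓕 (correlation ψ (pos z)) ((2 * Real.pi * ħ)⁻¹ • mom z) := by
  rw [wigner_eq_integral_correlation, Real.fourier_eq']
  congr 2
  ext y
  rw [smul_eq_mul, real_inner_smul_right, real_inner_comm]
  congr 2
  have hħ' : (ħ : ℂ) ≠ 0 := Complex.ofReal_ne_zero.2 hħ
  have hpi : (Real.pi : ℂ) ≠ 0 := Complex.ofReal_ne_zero.2 Real.pi_ne_zero
  push_cast
  field_simp

theorem correlation_ae_eq_of_wigner_eq (hħ : ħ ≠ 0) {ψ φ : Config n → ℂ}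
    (hψ : MemLp ψ 2 volume) (hφ : MemLp φ 2 volume)
    (h : ∀ z, wigner ħ ψ z = wigner ħ φ z) (x : Config n) :
    correlation ψ x =ᵐ[volume] correlation φ x := by
  have hpi := Real.pi_ne_zero
  refine ae_eq_of_fourier_eq (integrable_correlation hψ x) (integrable_correlation hφ x) ?_
  ext w
  obtain ⟨z, hpos, hmom⟩ := exists_pos_eq_mom_eq x ((2 * Real.pi * ħ) • w)
  have hc : (1 / (2 * Real.pi * ħ : ℂ)) ^ n ≠ 0 :=
    pow_ne_zero _ <| one_div_ne_zero <| mul_ne_zero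
      (mul_ne_zero two_ne_zero (Complex.ofReal_ne_zero.2 hpi)) (Complex.ofReal_ne_zero.2 hħ)
  have hfourier := h z
  rw [wigner_eq_fourier_correlation hħ, wigner_eq_fourier_correlation hħ, hpos, hmom, smul_smul,
    inv_mul_cancel₀ (by positivity), one_smul] at hfourier
  exact mul_left_cancel₀ hc hfourier

theorem wigner_smul_of_norm_eq_one (ħ : ℝ) {c : ℂ} (hc : ‖c‖ = 1) (φ : L2 n) (z : Phase n) :
    wigner ħ (c • φ : L2 n) z = wigner ħ φ z := by
  rw [wigner_congr_ae (Lp.coeFn_smul c φ)]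
  refine wigner_const_mul c |>.trans ?_
  rw [hc, Complex.ofReal_one, one_pow, one_mul]

theorem forall_wigner_eq_iff (hħ : ħ ≠ 0) {ψ φ : L2 n} :
    (∀ z, wigner ħ ψ z = wigner ħ φ z) ↔ ∃ γ : ℝ, ψ = Complex.exp (γ * Complex.I) • φ := by
  refine ⟨fun h => ?_, ?_⟩
  · have hmeas : MeasurableSet {q : Config n × Config n |
        ψ q.1 * star (ψ q.2) = φ q.1 * star (φ q.2)} := by
      have hψ := (Lp.stronglyMeasurable ψ).measurable
      have hφ := (Lp.stronglyMeasurable φ).measurable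
      exact measurableSet_eq_fun (by fun_prop) (by fun_prop)
    obtain ⟨c, hc, hψφ⟩ := exists_norm_eq_one_ae_eq_mul_of_ae_mul_star_eq <|
      ae_ae_of_forall_ae_add_sub hmeas
        (correlation_ae_eq_of_wigner_eq hħ (Lp.memLp ψ) (Lp.memLp φ) h)
    obtain ⟨γ, rfl⟩ := Complex.norm_eq_one_iff c |>.1 hc
    exact ⟨γ, Lp.ext (hψφ.trans (Lp.coeFn_smul (Complex.exp (γ * Complex.I)) φ).symm)⟩
  · rintro ⟨γ, rfl⟩ z
    exact wigner_smul_of_norm_eq_one ħ (Complex.norm_exp_ofReal_mul_I γ) φ z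

end Uniqueness

/-! ### The standard Gaussian -/

section Gaussian

/-- The standard Gaussian `(1/(πħ))^{n/4} exp(-|x|²/2ħ)`, that is, `ψ_{AB}` for `A = I`, `B = 0`. -/
noncomputable def stdGaussian (n : ℕ) (ħ : ℝ) (x : Config n) : ℂ :=
  (((1 / (Real.pi * ħ)) ^ ((n : ℝ) / 4) : ℝ) : ℂ)
    * Complex.exp ((-(1 / (2 * ħ)) * ‖x‖ ^ 2 : ℝ) : ℂ)

theorem continuous_stdGaussian (n : ℕ) (ħ : ℝ) : Continuous (stdGaussian n ħ) := by
  unfold stdGaussian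
  fun_prop

theorem sq_one_div_pi_mul_rpow (hħ : 0 < ħ) (n : ℕ) :
    ((1 / (Real.pi * ħ)) ^ ((n : ℝ) / 4)) ^ 2 = (1 / (Real.pi * ħ)) ^ ((n : ℝ) / 2) := by
  rw [← Real.rpow_two, ← Real.rpow_mul (by positivity)]
  ring_nf

theorem correlation_stdGaussian (hħ : 0 < ħ) (x y : Config n) :
    correlation (stdGaussian n ħ) x y = (((1 / (Real.pi * ħ)) ^ ((n : ℝ) / 2)
      * Real.exp (-(1 / ħ) * ‖x‖ ^ 2) * Real.exp (-(1 / (4 * ħ)) * ‖y‖ ^ 2) : ℝ) : ℂ) := by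
  have hnorm : ‖x + (1 / 2 : ℝ) • y‖ ^ 2 + ‖x - (1 / 2 : ℝ) • y‖ ^ 2
      = 2 * ‖x‖ ^ 2 + 1 / 2 * ‖y‖ ^ 2 := by
    rw [norm_add_sq_real, norm_sub_sq_real, norm_smul]
    norm_num
    ring
  have hexp : -(1 / (2 * ħ)) * ‖x + (1 / 2 : ℝ) • y‖ ^ 2
      + -(1 / (2 * ħ)) * ‖x - (1 / 2 : ℝ) • y‖ ^ 2
      = -(1 / ħ) * ‖x‖ ^ 2 + -(1 / (4 * ħ)) * ‖y‖ ^ 2 := by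
    rw [← mul_add, hnorm]
    field_simp
    ring
  unfold stdGaussian
  rw [correlation_const_mul, correlation_cexp, Complex.star_def, Complex.conj_ofReal,
    ← Complex.ofReal_add, hexp, ← Complex.ofReal_exp, Real.exp_add, Complex.norm_real,
    Real.norm_of_nonneg (Real.rpow_nonneg (by positivity) _), ← Complex.ofReal_pow,
    sq_one_div_pi_mul_rpow hħ, ← Complex.ofReal_mul, mul_assoc]

theorem memLp_stdGaussian (n : ℕ) (hħ : 0 < ħ) : MemLp (stdGaussian n ħ) 2 volume := by
  rw [memLp_two_iff_integrable_sq_norm (continuous_stdGaussian n ħ).aestronglyMeasurable]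
  have hgauss : Integrable fun x : Config n => Real.exp (-(1 / ħ) * ‖x‖ ^ 2) := by
    simpa [Complex.norm_exp, ← Complex.ofReal_pow] using
      (GaussianFourier.integrable_cexp_neg_mul_sq_norm_add (V := Config n)
        (b := (1 / ħ : ℝ)) (by simpa using hħ) 0 0).norm
  refine (hgauss.const_mul ((1 / (Real.pi * ħ)) ^ ((n : ℝ) / 2))).congr (.of_forall fun x => ?_)
  have hexp : -(1 / (2 * ħ)) * ‖x‖ ^ 2 * (2 : ℕ) = -(1 / ħ) * ‖x‖ ^ 2 := by
    push_cast
    field_simp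
  simp only [stdGaussian]
  rw [← Complex.ofReal_exp, ← Complex.ofReal_mul, Complex.norm_real, Real.norm_eq_abs, sq_abs,
    mul_pow, sq_one_div_pi_mul_rpow hħ, ← Real.exp_nat_mul, mul_comm ((2 : ℕ) : ℝ), hexp]

theorem wigner_constant_stdGaussian (hħ : 0 < ħ) (n : ℕ) :
    (1 / (2 * Real.pi * ħ)) ^ n * ((1 / (Real.pi * ħ)) ^ ((n : ℝ) / 2)
      * (4 * Real.pi * ħ) ^ ((n : ℝ) / 2)) = (1 / (Real.pi * ħ)) ^ n := by
  have hfour : 1 / (Real.pi * ħ) * (4 * Real.pi * ħ) = 2 ^ (2 : ℝ) := by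
    rw [Real.rpow_two]
    field_simp
    norm_num
  rw [← Real.mul_rpow (by positivity) (by positivity), hfour, ← Real.rpow_mul zero_le_two,
    mul_div_cancel₀ _ two_ne_zero, Real.rpow_natCast, ← mul_pow]
  congr 1
  field_simp

theorem integral_cexp_mul_exp_neg_sq_norm (hħ : 0 < ħ) (p : Config n) :
    ∫ y : Config n, Complex.exp (-(Complex.I / ħ) * (inner ℝ p y : ℝ))
        * (Real.exp (-(1 / (4 * ħ)) * ‖y‖ ^ 2) : ℝ)
      = ((4 * Real.pi * ħ) ^ ((n : ℝ) / 2) * Real.exp (-(1 / ħ) * ‖p‖ ^ 2) : ℝ) := by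
  have hħ' : (ħ : ℂ) ≠ 0 := Complex.ofReal_ne_zero.2 hħ.ne'
  have hb : 0 < (((1 / (4 * ħ) : ℝ) : ℂ)).re := by
    rw [Complex.ofReal_re]
    positivity
  have hconst : ((Real.pi : ℂ) / (1 / (4 * ħ) : ℝ)) ^ ((n : ℂ) / 2)
      = (((4 * Real.pi * ħ) ^ ((n : ℝ) / 2) : ℝ) : ℂ) := by
    rw [Complex.ofReal_cpow (by positivity)]
    push_cast
    field_simp
  have hexp : (-(Complex.I / ħ)) ^ 2 * (‖p‖ : ℂ) ^ 2 / (4 * (1 / (4 * ħ) : ℝ))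
      = ((-(1 / ħ) * ‖p‖ ^ 2 : ℝ) : ℂ) := by
    rw [neg_sq, div_pow, Complex.I_sq]
    push_cast
    field_simp
  have hgauss := GaussianFourier.integral_cexp_neg_mul_sq_norm_add hb (-(Complex.I / ħ)) p
  rw [finrank_euclideanSpace_fin, hconst, hexp, ← Complex.ofReal_exp, ← Complex.ofReal_mul]
    at hgauss
  rw [← hgauss]
  refine integral_congr_ae (.of_forall fun y => ?_)
  simp only [Complex.ofReal_exp, ← Complex.exp_add]
  push_cast
  ring_nf

theorem wigner_stdGaussian (hħ : 0 < ħ) (z : Phase n) :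
    wigner ħ (stdGaussian n ħ) z
      = (((1 / (Real.pi * ħ)) ^ n * Real.exp (-(1 / ħ) * ‖z‖ ^ 2) : ℝ) : ℂ) := by
  rw [wigner_eq_integral_correlation]
  have hkernel : ∀ y : Config n, Complex.exp (-(Complex.I / ħ) * (inner ℝ (mom z) y : ℝ))
      * correlation (stdGaussian n ħ) (pos z) y
      = (((1 / (Real.pi * ħ)) ^ ((n : ℝ) / 2) * Real.exp (-(1 / ħ) * ‖pos z‖ ^ 2) : ℝ) : ℂ)
        * (Complex.exp (-(Complex.I / ħ) * (inner ℝ (mom z) y : ℝ))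
          * (Real.exp (-(1 / (4 * ħ)) * ‖y‖ ^ 2) : ℝ)) := fun y => by
    rw [correlation_stdGaussian hħ, Complex.ofReal_mul, mul_left_comm]
  simp only [hkernel]
  rw [integral_const_mul, integral_cexp_mul_exp_neg_sq_norm hħ, ← wigner_constant_stdGaussian hħ n,
    norm_sq_eq_pos_add_mom, mul_add, Real.exp_add]
  push_cast
  ring

end Gaussian

/-! ### States with Gaussian Wigner transform -/

/-- The class of the standard Gaussian in `L²(ℝⁿ)`. -/
noncomputable def groundState (n : ℕ) (hħ : 0 < ħ) : L2 n := (memLp_stdGaussian n hħ).toLp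

theorem groundState_ae_eq (n : ℕ) (hħ : 0 < ħ) :
    groundState n hħ =ᵐ[volume] stdGaussian n ħ :=
  (memLp_stdGaussian n hħ).coeFn_toLp

theorem wigner_groundState (hħ : 0 < ħ) (z : Phase n) :
    wigner ħ (groundState n hħ) z
      = (((1 / (Real.pi * ħ)) ^ n * Real.exp (-(1 / ħ) * ‖z‖ ^ 2) : ℝ) : ℂ) := by
  rw [wigner_congr_ae (groundState_ae_eq n hħ), wigner_stdGaussian hħ]

/-- The state whose Wigner transform is that of the standard Gaussian, transported by `f`. -/
def stateOf (ħ : ℝ) (f : Equiv.Perm (Phase n)) : Set (L2 n) :=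
  {ψ | ∀ z, wigner ħ ψ z
    = (((1 / (Real.pi * ħ)) ^ n * Real.exp (-(1 / ħ) * ‖f⁻¹ z‖ ^ 2) : ℝ) : ℂ)}

theorem stateOf_congr {f g : Equiv.Perm (Phase n)} (h : ∀ z, ‖f⁻¹ z‖ = ‖g⁻¹ z‖) :
    stateOf ħ f = stateOf ħ g := by
  simp only [stateOf, h]

namespace WignerCovariant

variable {U : UnitaryOp n} {f : Equiv.Perm (Phase n)}

theorem wigner_apply (hU : WignerCovariant ħ U f) (ψ : L2 n) (z : Phase n) :
    wigner ħ (U ψ) z = wigner ħ ψ (f⁻¹ z) := by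
  have hcov := hU ψ (f.symm z)
  rwa [f.apply_symm_apply] at hcov

theorem apply_mem_stateOf (hU : WignerCovariant ħ U f) {g : Equiv.Perm (Phase n)} {ψ : L2 n}
    (hψ : ψ ∈ stateOf ħ g) : U ψ ∈ stateOf ħ (f * g) := fun z => by
  rw [hU.wigner_apply, hψ, _root_.mul_inv_rev, Equiv.Perm.mul_apply]

theorem image_stateOf (hU : WignerCovariant ħ U f) (g : Equiv.Perm (Phase n)) :
    U '' stateOf ħ g = stateOf ħ (f * g) := by
  refine Set.Subset.antisymm ?_ fun ψ hψ => ?_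
  · rintro _ ⟨ψ, hψ, rfl⟩
    exact hU.apply_mem_stateOf hψ
  · have hψ' := hU.inv.apply_mem_stateOf hψ
    rw [inv_mul_cancel_left] at hψ'
    exact ⟨U⁻¹ ψ, hψ', U.apply_symm_apply ψ⟩

theorem groundState_mem_stateOf (hħ : 0 < ħ) (hU : WignerCovariant ħ U f) :
    U (groundState n hħ) ∈ stateOf ħ f := fun z => by
  rw [hU.wigner_apply, wigner_groundState]

theorem mem_stateOf_iff (hħ : 0 < ħ) (hU : WignerCovariant ħ U f) {ψ : L2 n} :
    ψ ∈ stateOf ħ f ↔ ∃ γ : ℝ, ψ = Complex.exp (γ * Complex.I) • U (groundState n hħ) := by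
  rw [← forall_wigner_eq_iff hħ.ne']
  exact forall_congr' fun z => by rw [hU.groundState_mem_stateOf hħ z]

end WignerCovariant

/-! ### The projections -/

theorem eq_of_forall_wigner_eq (hħ : 0 < ħ) {z w : Phase n}
    (h : ∀ ψ : L2 n, wigner ħ ψ z = wigner ħ ψ w) : z = w := by
  have hstate := (wignerCovariant_heisenberg ħ w).groundState_mem_stateOf hħ
  have hnorm (v : Phase n) : ‖(translation w)⁻¹ v‖ = ‖v - w‖ := by rw [sub_eq_add_neg]; rfl
  have hexp := (hstate z).symm.trans ((h _).trans (hstate w))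
  rw [Complex.ofReal_inj, mul_right_inj' (by positivity), Real.exp_eq_exp,
    mul_right_inj' (by simp [hħ.ne']), hnorm, hnorm, sub_self, norm_zero] at hexp
  simpa [sub_eq_zero] using hexp

theorem WignerCovariant.unique (hħ : 0 < ħ) {U : UnitaryOp n} {f g : Equiv.Perm (Phase n)}
    (hf : WignerCovariant ħ U f) (hg : WignerCovariant ħ U g) : f = g := by
  refine inv_injective (Equiv.ext fun z => eq_of_forall_wigner_eq hħ fun ψ => ?_)
  rw [← hf.wigner_apply, ← hg.wigner_apply]

theorem spMap_injective : Function.Injective (spMap n) := fun _ _ h =>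
  Subtype.ext <| Matrix.ext_of_mulVec_single fun i =>
    congrArg WithLp.ofLp (DFunLike.congr_fun h (WithLp.toLp 2 (Pi.single i 1)))

theorem spMap_mem_ISp (S : Sp n) : spMap n S ∈ ISp n :=
  ⟨S, 0, by ext1 z; simp [translation]⟩

theorem range_spMap_le_ISp : (spMap n).range ≤ ISp n := by
  rintro _ ⟨S, rfl⟩
  exact spMap_mem_ISp S

theorem translation_mem_ISp (z₀ : Phase n) : translation z₀ ∈ ISp n :=
  ⟨1, z₀, by rw [map_one, one_mul]⟩

/-- The group of unitary operators that cover an element of `G`. -/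
def coveringSubgroup (ħ : ℝ) (G : Subgroup (Equiv.Perm (Phase n))) : Subgroup (UnitaryOp n) where
  carrier := {U | ∃ f ∈ G, WignerCovariant ħ U f}
  one_mem' := ⟨1, one_mem G, .one ħ⟩
  mul_mem' := by
    rintro U V ⟨f, hf, hU⟩ ⟨g, hg, hV⟩
    exact ⟨f * g, mul_mem hf hg, hU.mul hV⟩
  inv_mem' := by
    rintro U ⟨f, hf, hU⟩
    exact ⟨f⁻¹, inv_mem hf, hU.inv⟩

theorem coveringSubgroup_mono {G H : Subgroup (Equiv.Perm (Phase n))} (h : G ≤ H) :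
    coveringSubgroup ħ G ≤ coveringSubgroup ħ H := by
  rintro U ⟨f, hf, hU⟩
  exact ⟨f, h hf, hU⟩

theorem Mp_le_coveringSubgroup (hħ : 0 < ħ) : Mp n hħ ≤ coveringSubgroup ħ (spMap n).range := by
  refine (Subgroup.closure_le _).2 ?_
  rintro U ((rfl | ⟨P, hP, rfl⟩) | ⟨L, m, -, rfl⟩)
  · exact ⟨_, ⟨_, rfl⟩, wignerCovariant_opJ hħ⟩
  · exact ⟨_, ⟨_, rfl⟩, wignerCovariant_opV ħ hP⟩
  · exact ⟨_, ⟨_, rfl⟩, wignerCovariant_opM ħ L m⟩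

theorem IMp_le_coveringSubgroup (hħ : 0 < ħ) : IMp n hħ ≤ coveringSubgroup ħ (ISp n) := by
  refine (Subgroup.closure_le _).2 (Set.union_subset ?_ ?_)
  · exact (Mp_le_coveringSubgroup hħ).trans (coveringSubgroup_mono range_spMap_le_ISp)
  · rintro _ ⟨z₀, rfl⟩
    exact ⟨_, translation_mem_ISp z₀, wignerCovariant_heisenberg ħ z₀⟩

theorem exists_wignerCovariant {G : Subgroup (Equiv.Perm (Phase n))} (U : coveringSubgroup ħ G) :
    ∃ f : G, WignerCovariant ħ (U : UnitaryOp n) f := by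
  obtain ⟨U, f, hf, hU⟩ := U
  exact ⟨⟨f, hf⟩, hU⟩

/-- The homomorphism that sends an operator to the transformation it covers. -/
noncomputable def coveredMap (hħ : 0 < ħ) (G : Subgroup (Equiv.Perm (Phase n))) :
    coveringSubgroup ħ G →* G :=
  MonoidHom.mk' (fun U => (exists_wignerCovariant U).choose) fun U V =>
    Subtype.ext <| (exists_wignerCovariant (U * V)).choose_spec.unique hħ <|
      (exists_wignerCovariant U).choose_spec.mul (exists_wignerCovariant V).choose_spec

theorem wignerCovariant_coveredMap (hħ : 0 < ħ) {G : Subgroup (Equiv.Perm (Phase n))}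
    (U : coveringSubgroup ħ G) :
    WignerCovariant ħ (U : UnitaryOp n) (coveredMap hħ G U : Equiv.Perm (Phase n)) :=
  (exists_wignerCovariant U).choose_spec

/-- The natural projection `Mp(n) → Sp(n)`. -/
noncomputable def projMp (hħ : 0 < ħ) : Mp n hħ →* Sp n :=
  (MonoidHom.ofInjective spMap_injective).symm.toMonoidHom.comp <|
    (coveredMap hħ (spMap n).range).comp (Subgroup.inclusion (Mp_le_coveringSubgroup hħ))

/-- The natural projection `IMp(n) → ISp(n)`. -/
noncomputable def projIMp (hħ : 0 < ħ) : IMp n hħ →* ISp n :=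
  (coveredMap hħ (ISp n)).comp (Subgroup.inclusion (IMp_le_coveringSubgroup hħ))

theorem wignerCovariant_projIMp (hħ : 0 < ħ) (U : IMp n hħ) :
    WignerCovariant ħ (U : UnitaryOp n) (projIMp hħ U : Equiv.Perm (Phase n)) :=
  wignerCovariant_coveredMap hħ (Subgroup.inclusion (IMp_le_coveringSubgroup hħ) U)

theorem wignerCovariant_projMp (hħ : 0 < ħ) (U : Mp n hħ) :
    WignerCovariant ħ (U : UnitaryOp n) (spMap n (projMp hħ U)) := by
  have hcov := wignerCovariant_coveredMap hħ (Subgroup.inclusion (Mp_le_coveringSubgroup hħ) U)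
  rwa [← MonoidHom.apply_ofInjective_symm spMap_injective] at hcov

theorem projMp_eq (hħ : 0 < ħ) {U : Mp n hħ} {S : Sp n}
    (h : WignerCovariant ħ (U : UnitaryOp n) (spMap n S)) : projMp hħ U = S :=
  spMap_injective ((wignerCovariant_projMp hħ U).unique hħ h)

theorem projMp_opJ (n : ℕ) (hħ : 0 < ħ) :
    projMp hħ ⟨opJ n hħ, opJ_mem n hħ⟩ = quarterTurn (Fin n) ℝ :=
  projMp_eq hħ (wignerCovariant_opJ hħ)

theorem projMp_opV (hħ : 0 < ħ) {P : Matrix (Fin n) (Fin n) ℝ} (hP : P.IsSymm) :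
    projMp hħ ⟨opV ħ P, opV_mem hħ hP⟩ = lowerShear (-P) hP.neg :=
  projMp_eq hħ (wignerCovariant_opV ħ hP)

theorem projMp_opM (hħ : 0 < ħ) {L : GL (Fin n) ℝ} {m : ℤ}
    (hm : (-1 : ℝ) ^ m * |(L : Matrix (Fin n) (Fin n) ℝ).det|
      = (L : Matrix (Fin n) (Fin n) ℝ).det) :
    projMp hħ ⟨opM L m, opM_mem hħ hm⟩ = blockDiagonal L :=
  projMp_eq hħ (wignerCovariant_opM ħ L m)

theorem projIMp_mul_heisenberg (hħ : 0 < ħ) (U : Mp n hħ) (z₀ : Phase n) :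
    projIMp hħ ⟨(U : UnitaryOp n) * heisenberg ħ z₀, Mp_mul_heisenberg_mem hħ U z₀⟩
      = ⟨spMap n (projMp hħ U) * translation z₀, spMap_mul_translation_mem (projMp hħ U) z₀⟩ :=
  Subtype.ext <| (wignerCovariant_projIMp hħ _).unique hħ <|
    (wignerCovariant_projMp hħ U).mul (wignerCovariant_heisenberg ħ z₀)

theorem exists_neg_one_zpow_mul_abs_eq (x : ℝ) : ∃ m : ℤ, (-1 : ℝ) ^ m * |x| = x := by
  rcases le_total 0 x with hx | hx
  · exact ⟨0, by rw [zpow_zero, one_mul, abs_of_nonneg hx]⟩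
  · exact ⟨1, by rw [zpow_one, abs_of_nonpos hx, neg_one_mul, neg_neg]⟩

theorem projMp_surjective (hħ : 0 < ħ) : Function.Surjective (projMp (n := n) hħ) := by
  refine MonoidHom.range_eq_top.1 <| symplecticGroup_subgroup_eq_top
    ⟨_, projMp_opJ n hħ⟩ (fun P hP => ⟨_, (projMp_opV hħ hP.neg).trans ?_⟩) fun L => ?_
  · simp only [neg_neg]
  · obtain ⟨m, hm⟩ := exists_neg_one_zpow_mul_abs_eq (L : Matrix (Fin n) (Fin n) ℝ).det
    exact ⟨_, projMp_opM hħ hm⟩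

theorem projIMp_surjective (hħ : 0 < ħ) : Function.Surjective (projIMp (n := n) hħ) := by
  rintro ⟨_, S, z₀, rfl⟩
  obtain ⟨U, rfl⟩ := projMp_surjective hħ S
  exact ⟨_, projIMp_mul_heisenberg hħ U z₀⟩

theorem stateOf_nonempty (hħ : 0 < ħ) {f : Equiv.Perm (Phase n)} (hf : f ∈ ISp n) :
    (stateOf ħ f).Nonempty := by
  obtain ⟨U, hU⟩ := projIMp_surjective hħ ⟨f, hf⟩
  have hcov := wignerCovariant_projIMp hħ U
  rw [hU] at hcov
  exact ⟨_, hcov.groundState_mem_stateOf hħ⟩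

/-! ### The Gaussian states as transported ground states -/

theorem norm_lin_sq {ι : Type*} [Fintype ι] (M : Matrix ι ι ℝ) (v : EuclideanSpace ℝ ι) :
    ‖lin M v‖ ^ 2 = quad (Mᵀ * M) v := by
  rw [← real_inner_self_eq_norm_sq, quad_eq_inner_lin, lin_mul, inner_lin_left Mᵀ,
    transpose_transpose]

theorem quad_inv_mul_transpose (S : Sp n) (z : Phase n) :
    quad ((S : Matrix (Fin n ⊕ Fin n) (Fin n ⊕ Fin n) ℝ) * (S : Matrix _ _ ℝ)ᵀ)⁻¹ z
      = ‖(spMap n S)⁻¹ z‖ ^ 2 := by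
  rw [Matrix.mul_inv_rev, ← Matrix.transpose_nonsing_inv, ← SymplecticGroup.coe_inv',
    ← norm_lin_sq, ← map_inv]
  rfl

section PosDef

variable {A B : Matrix (Fin n) (Fin n) ℝ}

theorem sqrt_mul_sqrt (hA : A.PosDef) : CFC.sqrt A * CFC.sqrt A = A :=
  CFC.sqrt_mul_sqrt_self A hA.posSemidef.nonneg

theorem posSemidef_sqrt (A : Matrix (Fin n) (Fin n) ℝ) : (CFC.sqrt A).PosSemidef :=
  Matrix.nonneg_iff_posSemidef.1 (CFC.sqrt_nonneg A)

theorem transpose_sqrt (A : Matrix (Fin n) (Fin n) ℝ) : (CFC.sqrt A)ᵀ = CFC.sqrt A := by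
  rw [← Matrix.conjTranspose_eq_transpose_of_trivial]
  exact (posSemidef_sqrt A).isHermitian

theorem det_sqrt_pos (hA : A.PosDef) : 0 < (CFC.sqrt A).det := by
  refine (posSemidef_sqrt A).det_nonneg.lt_of_ne' fun hzero => hA.det_pos.ne' ?_
  rw [← sqrt_mul_sqrt hA, Matrix.det_mul, hzero, zero_mul]

theorem sqrt_abs_det_sqrt (hA : A.PosDef) : √|(CFC.sqrt A).det| = A.det ^ (1 / 4 : ℝ) := by
  have hdet : A.det = (CFC.sqrt A).det ^ (2 : ℝ) := by
    conv_lhs => rw [← sqrt_mul_sqrt hA, Matrix.det_mul]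
    rw [Real.rpow_two, sq]
  rw [hdet, ← Real.rpow_mul (det_sqrt_pos hA).le, abs_of_pos (det_sqrt_pos hA), Real.sqrt_eq_rpow]
  norm_num

theorem norm_lin_sqrt_sq (hA : A.PosDef) (v : Config n) : ‖lin (CFC.sqrt A) v‖ ^ 2 = quad A v := by
  rw [norm_lin_sq, transpose_sqrt, sqrt_mul_sqrt hA]

/-- The square root of a positive definite matrix, as an invertible matrix. -/
noncomputable def sqrtUnit (hA : A.PosDef) : GL (Fin n) ℝ :=
  Matrix.GeneralLinearGroup.mkOfDetNeZero (CFC.sqrt A) (det_sqrt_pos hA).ne'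

theorem coe_sqrtUnit (hA : A.PosDef) : (sqrtUnit hA : Matrix (Fin n) (Fin n) ℝ) = CFC.sqrt A := rfl

theorem matS_eq_lowerShear_mul_blockDiagonal (hA : A.PosDef) (hB : B.IsSymm) :
    matS A B = (lowerShear (-B) hB.neg * blockDiagonal (sqrtUnit hA) : Sp n) := by
  simp [matS, lowerShear, blockDiagonal, Matrix.fromBlocks_multiply, coe_sqrtUnit, transpose_sqrt]

theorem matS_mem (hA : A.PosDef) (hB : B.IsSymm) : matS A B ∈ Sp n := by
  rw [matS_eq_lowerShear_mul_blockDiagonal hA hB]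
  exact SetLike.coe_mem _

theorem wignerCovariant_opV_mul_opM_sqrtUnit (ħ : ℝ) (hA : A.PosDef) (hB : B.IsSymm) :
    WignerCovariant ħ (opV ħ B * opM (sqrtUnit hA) 0) (spMap n ⟨matS A B, matS_mem hA hB⟩) := by
  have hS : (⟨matS A B, matS_mem hA hB⟩ : Sp n)
      = lowerShear (-B) hB.neg * blockDiagonal (sqrtUnit hA) :=
    Subtype.ext (matS_eq_lowerShear_mul_blockDiagonal hA hB)
  rw [hS, map_mul]
  exact (wignerCovariant_opV ħ hB).mul (wignerCovariant_opM ħ _ 0)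

theorem opV_mul_opM_sqrtUnit_groundState (hħ : 0 < ħ) (hA : A.PosDef)
    (B : Matrix (Fin n) (Fin n) ℝ) :
    (opV ħ B * opM (sqrtUnit hA) 0) (groundState n hħ) =ᵐ[volume] fun x =>
      (((1 / (Real.pi * ħ)) ^ ((n : ℝ) / 4) : ℝ) : ℂ) * ((A.det ^ (1 / 4 : ℝ) : ℝ) : ℂ)
        * Complex.exp (-(1 / (2 * ħ)) * (quad A x + Complex.I * quad B x)) := by
  filter_upwards [opV_apply ħ B (opM (sqrtUnit hA) 0 (groundState n hħ)),
    opM_apply (sqrtUnit hA) 0 (groundState n hħ),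
    ae_comp_of_map (map_linEquiv (sqrtUnit hA)) (groundState_ae_eq n hħ)] with x hV hM hground
  have hground' : groundState n hħ (lin (CFC.sqrt A) x) = stdGaussian n ħ (lin (CFC.sqrt A) x) :=
    hground
  rw [unitaryOp_mul_apply, hV, hM, coe_sqrtUnit, hground', sqrt_abs_det_sqrt hA, stdGaussian,
    norm_lin_sqrt_sq hA, zpow_zero, one_mul, mul_add, Complex.exp_add]
  have hphase : Complex.exp (((-(1 / (2 * ħ)) * quad B x : ℝ) : ℂ) * Complex.I)
      = Complex.exp (-(1 / (2 * ħ)) * (Complex.I * quad B x)) := by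
    congr 1
    push_cast
    ring
  rw [hphase]
  push_cast
  ring

theorem mem_wavepacket_iff (hħ : 0 < ħ) (hA : A.PosDef) {ψ : L2 n} :
    ψ ∈ wavepacket ħ A B ↔ ∃ γ : ℝ, ψ = Complex.exp (γ * Complex.I) •
      (opV ħ B * opM (sqrtUnit hA) 0) (groundState n hħ) := by
  refine exists_congr fun γ => ?_
  set φ := (opV ħ B * opM (sqrtUnit hA) 0) (groundState n hħ) with hφ
  have hsmul : (Complex.exp (γ * Complex.I) • φ : L2 n) =ᵐ[volume] fun x =>
      Complex.exp (γ * Complex.I) * (((1 / (Real.pi * ħ)) ^ ((n : ℝ) / 4) : ℝ) : ℂ)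
        * ((A.det ^ (1 / 4 : ℝ) : ℝ) : ℂ)
        * Complex.exp (-(1 / (2 * ħ)) * (quad A x + Complex.I * quad B x)) := by
    filter_upwards [Lp.coeFn_smul (Complex.exp (γ * Complex.I)) φ,
      opV_mul_opM_sqrtUnit_groundState hħ hA B] with x hx hground
    rw [hx, Pi.smul_apply, hφ, hground, smul_eq_mul, ← mul_assoc, ← mul_assoc]
  exact ⟨fun h => Lp.ext (h.trans hsmul.symm), fun h => h ▸ hsmul⟩

theorem wavepacket_eq_stateOf (hħ : 0 < ħ) (hA : A.PosDef) (hB : B.IsSymm) :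
    wavepacket ħ A B = stateOf ħ (spMap n ⟨matS A B, matS_mem hA hB⟩) := by
  ext ψ
  rw [mem_wavepacket_iff hħ hA, (wignerCovariant_opV_mul_opM_sqrtUnit ħ hA hB).mem_stateOf_iff hħ]

theorem gaussState_eq_stateOf (hħ : 0 < ħ) (z₀ : Phase n) (hA : A.PosDef) (hB : B.IsSymm) :
    gaussState ħ z₀ A B = stateOf ħ (translation z₀ * spMap n ⟨matS A B, matS_mem hA hB⟩) := by
  rw [gaussState, wavepacket_eq_stateOf hħ hA hB,
    (wignerCovariant_heisenberg ħ z₀).image_stateOf]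

theorem quad_matG_sub (hA : A.PosDef) (hB : B.IsSymm) (z₀ z : Phase n) :
    quad (matG A B) (z - z₀)
      = ‖(translation z₀ * spMap n ⟨matS A B, matS_mem hA hB⟩)⁻¹ z‖ ^ 2 := by
  refine (quad_inv_mul_transpose ⟨matS A B, matS_mem hA hB⟩ (z - z₀)).trans ?_
  rw [_root_.mul_inv_rev, Equiv.Perm.mul_apply, sub_eq_add_neg]
  rfl

theorem mem_gaussState_iff (hħ : 0 < ħ) (hA : A.PosDef) (hB : B.IsSymm) (z₀ : Phase n)
    (ψ : L2 n) :
    ψ ∈ gaussState ħ z₀ A B ↔ ∀ z : Phase n, wigner ħ ψ z = (((1 / (Real.pi * ħ)) ^ n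
      * Real.exp (-(1 / ħ) * quad (matG A B) (z - z₀)) : ℝ) : ℂ) := by
  simp only [gaussState_eq_stateOf hħ z₀ hA hB, quad_matG_sub hA hB]
  rfl

theorem matS_mul_transpose (hA : A.PosDef) (B : Matrix (Fin n) (Fin n) ℝ) :
    matS A B * (matS A B)ᵀ
      = fromBlocks 1 0 (-B) 1 * fromBlocks A⁻¹ 0 0 A * (fromBlocks 1 0 (-B) 1)ᵀ := by
  have hS : matS A B
      = fromBlocks 1 0 (-B) 1 * fromBlocks (CFC.sqrt A)⁻¹ 0 0 (CFC.sqrt A) := by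
    simp [matS, Matrix.fromBlocks_multiply]
  have hdiag : fromBlocks (CFC.sqrt A)⁻¹ 0 0 (CFC.sqrt A)
      * (fromBlocks (CFC.sqrt A)⁻¹ 0 0 (CFC.sqrt A))ᵀ = fromBlocks A⁻¹ 0 0 A := by
    simp [Matrix.fromBlocks_transpose, Matrix.fromBlocks_multiply, Matrix.transpose_nonsing_inv,
      transpose_sqrt, ← Matrix.mul_inv_rev, sqrt_mul_sqrt hA]
  rw [hS, Matrix.transpose_mul, Matrix.mul_assoc, ← Matrix.mul_assoc _ _ (fromBlocks 1 0 (-B) 1)ᵀ,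
    hdiag, Matrix.mul_assoc]

end PosDef

theorem exists_norm_spMap_inv_eq_norm_spMap_matS_inv (S : Sp n) :
    ∃ (A B : Matrix (Fin n) (Fin n) ℝ) (hA : A.PosDef) (hB : B.IsSymm), ∀ z,
      ‖(spMap n S)⁻¹ z‖ = ‖(spMap n ⟨matS A B, matS_mem hA hB⟩)⁻¹ z‖ := by
  obtain ⟨A, B, hA, hB, hS⟩ := exists_shear_mul_diagonal_eq_mul_transpose S.2
  refine ⟨A, B, hA, hB, fun z => ?_⟩
  rw [← sq_eq_sq₀ (norm_nonneg _) (norm_nonneg _), ← quad_inv_mul_transpose,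
    ← quad_inv_mul_transpose, hS, ← matS_mul_transpose hA]

/-- The set of the states transported from the ground state by the elements of `G`. -/
def statesOf (ħ : ℝ) (G : Subgroup (Equiv.Perm (Phase n))) : Set (Set (L2 n)) :=
  {s | ∃ f ∈ G, s = stateOf ħ f}

theorem Gauss₀_eq_statesOf (hħ : 0 < ħ) : Gauss₀ n ħ = statesOf ħ (spMap n).range := by
  refine Set.Subset.antisymm ?_ ?_
  · rintro _ ⟨A, B, hA, hB, rfl⟩
    exact ⟨_, ⟨_, rfl⟩, wavepacket_eq_stateOf hħ hA hB⟩
  · rintro _ ⟨_, ⟨S, rfl⟩, rfl⟩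
    obtain ⟨A, B, hA, hB, hnorm⟩ := exists_norm_spMap_inv_eq_norm_spMap_matS_inv S
    exact ⟨A, B, hA, hB, (stateOf_congr hnorm).trans (wavepacket_eq_stateOf hħ hA hB).symm⟩

theorem Gauss_eq_statesOf (hħ : 0 < ħ) : Gauss n ħ = statesOf ħ (ISp n) := by
  refine Set.Subset.antisymm ?_ ?_
  · rintro _ ⟨z₀, A, B, hA, hB, rfl⟩
    exact ⟨_, mul_mem (translation_mem_ISp z₀) (spMap_mem_ISp _),
      gaussState_eq_stateOf hħ z₀ hA hB⟩
  · rintro _ ⟨_, ⟨S, z₀, rfl⟩, rfl⟩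
    obtain ⟨A, B, hA, hB, hnorm⟩ := exists_norm_spMap_inv_eq_norm_spMap_matS_inv S
    refine ⟨spMap n S z₀, A, B, hA, hB, ?_⟩
    rw [translation_mul_spMap, gaussState_eq_stateOf hħ _ hA hB]
    exact stateOf_congr fun z => by
      simpa only [_root_.mul_inv_rev, Equiv.Perm.mul_apply] using hnorm _

theorem WignerCovariant.image_mem_statesOf {U : UnitaryOp n} {f : Equiv.Perm (Phase n)}
    (hU : WignerCovariant ħ U f) {G : Subgroup (Equiv.Perm (Phase n))} (hf : f ∈ G)
    {s : Set (L2 n)} (hs : s ∈ statesOf ħ G) : U '' s ∈ statesOf ħ G := by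
  obtain ⟨g, hg, rfl⟩ := hs
  exact ⟨f * g, mul_mem hf hg, hU.image_stateOf g⟩

theorem exists_forall_wignerCovariant_image_eq {G : Subgroup (Equiv.Perm (Phase n))}
    {s s' : Set (L2 n)} (hs : s ∈ statesOf ħ G) (hs' : s' ∈ statesOf ħ G) :
    ∃ f ∈ G, ∀ U : UnitaryOp n, WignerCovariant ħ U f → U '' s = s' := by
  obtain ⟨g, hg, rfl⟩ := hs
  obtain ⟨g', hg', rfl⟩ := hs'
  exact ⟨g' * g⁻¹, mul_mem hg' (inv_mem hg), fun U hU => by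
    rw [hU.image_stateOf, inv_mul_cancel_right]⟩

/-! ### Affine maps that preserve a ball -/

section Ball

variable {E : Type*} [NormedAddCommGroup E] [NormedSpace ℝ E] {r : ℝ}

theorem norm_div_norm_smul (hr : 0 ≤ r) {v : E} (hv : v ≠ 0) : ‖(r / ‖v‖) • v‖ = r := by
  rw [norm_smul, Real.norm_of_nonneg (by positivity), div_mul_cancel₀ _ (norm_ne_zero_iff.2 hv)]

theorem norm_apply_le_of_mapsTo_closedBall {F : Type*} [NormedAddCommGroup F] [NormedSpace ℝ F]
    {T : E →ₗ[ℝ] F} (hr : 0 < r)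
    (h : Set.MapsTo T (Metric.closedBall 0 r) (Metric.closedBall 0 r)) (v : E) :
    ‖T v‖ ≤ ‖v‖ := by
  rcases eq_or_ne v 0 with rfl | hv
  · simp
  have hT := mem_closedBall_zero_iff.1
    (h (mem_closedBall_zero_iff.2 (norm_div_norm_smul hr.le hv).le))
  rw [map_smul, norm_smul, Real.norm_of_nonneg (by positivity), div_mul_eq_mul_div,
    div_le_iff₀ (norm_pos_iff.2 hv)] at hT
  exact le_of_mul_le_mul_left hT hr

theorem norm_apply_eq_of_image_closedBall_eq {T : E ≃ₗ[ℝ] E} (hr : 0 < r)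
    (h : T '' Metric.closedBall 0 r = Metric.closedBall 0 r) (v : E) : ‖T v‖ = ‖v‖ := by
  have hT : Set.MapsTo (T : E →ₗ[ℝ] E) (Metric.closedBall 0 r) (Metric.closedBall 0 r) :=
    Set.mapsTo_iff_image_subset.2 h.subset
  have hT' : Set.MapsTo (T.symm : E →ₗ[ℝ] E) (Metric.closedBall 0 r) (Metric.closedBall 0 r) := by
    intro u hu
    obtain ⟨v, hv, rfl⟩ := h.superset hu
    rwa [LinearEquiv.coe_coe, T.symm_apply_apply]
  refine (norm_apply_le_of_mapsTo_closedBall hr hT v).antisymm ?_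
  simpa using norm_apply_le_of_mapsTo_closedBall hr hT' (T v)

theorem eq_zero_of_image_add_closedBall_eq {T : E →ₗ[ℝ] E} {w : E} (hr : 0 ≤ r)
    (h : (fun v => T v + w) '' Metric.closedBall 0 r = Metric.closedBall 0 r) : w = 0 := by
  by_contra hw
  -- The ball is symmetric about the origin and its image about `w`, so it is invariant under
  -- translation by `2w`.
  have hshift (u : E) (hu : ‖u‖ ≤ r) : ‖u - (2 : ℝ) • w‖ ≤ r := by
    obtain ⟨v, hv, rfl⟩ := h.superset (mem_closedBall_zero_iff.2 hu)
    have hneg := h.subset ⟨-v, by simpa using hv, rfl⟩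
    rw [mem_closedBall_zero_iff, ← norm_neg] at hneg
    have hreflect : T v + w - (2 : ℝ) • w = -(T (-v) + w) := by
      rw [map_neg]
      module
    rwa [hreflect]
  have hnorm := hshift (-((r / ‖w‖) • w)) (by rw [norm_neg, norm_div_norm_smul hr hw])
  have hcollinear : -((r / ‖w‖) • w) - (2 : ℝ) • w = -((r / ‖w‖ + 2) • w) := by module
  rw [hcollinear, norm_neg, norm_smul, Real.norm_of_nonneg (by positivity), add_mul,
    div_mul_cancel₀ _ (norm_ne_zero_iff.2 hw)] at hnorm
  linarith [norm_pos_iff.2 hw]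

end Ball

theorem norm_apply_eq_of_mem_ISp {f : Equiv.Perm (Phase n)} (hf : f ∈ ISp n) {r : ℝ} (hr : 0 < r)
    (h : f '' Metric.closedBall 0 r = Metric.closedBall 0 r) (z : Phase n) : ‖f z‖ = ‖z‖ := by
  obtain ⟨S, z₀, rfl⟩ := hf
  let T : Phase n ≃ₗ[ℝ] Phase n :=
    { spMap n S with
      map_add' := lin_add _
      map_smul' := fun c v => lin_smul _ v c }
  have hT (v : Phase n) : (spMap n S * translation z₀) v = T v + T z₀ := map_add T v z₀
  have hz₀ : T z₀ = 0 := eq_zero_of_image_add_closedBall_eq (T := (T : Phase n →ₗ[ℝ] Phase n))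
    hr.le (by simpa only [hT, LinearEquiv.coe_coe] using h)
  simp only [hT, hz₀, add_zero] at h ⊢
  exact norm_apply_eq_of_image_closedBall_eq hr h z

/-! ### The quantum blob of a state -/

/-- The superlevel set of the Wigner transform of a state at `e⁻¹` times `(πħ)⁻ⁿ`, the maximal
value attained for a Gaussian state. -/
noncomputable def blob (ħ : ℝ) (s : Set (L2 n)) : Set (Phase n) :=
  {z | ∃ ψ ∈ s, (1 / (Real.pi * ħ)) ^ n * Real.exp (-1) ≤ (wigner ħ ψ z).re}

theorem WignerCovariant.blob_image {U : UnitaryOp n} {f : Equiv.Perm (Phase n)}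
    (hU : WignerCovariant ħ U f) (s : Set (L2 n)) : blob ħ (U '' s) = f '' blob ħ s := by
  ext z
  rw [Equiv.image_eq_preimage_symm]
  simp only [blob, Set.exists_mem_image, hU.wigner_apply]
  rfl

theorem blob_stateOf (hħ : 0 < ħ) {f : Equiv.Perm (Phase n)} (hf : f ∈ ISp n) :
    blob ħ (stateOf ħ f) = f '' Metric.closedBall 0 √ħ := by
  have hle (ψ : L2 n) (hψ : ψ ∈ stateOf ħ f) (z : Phase n) :
      (1 / (Real.pi * ħ)) ^ n * Real.exp (-1) ≤ (wigner ħ ψ z).re ↔ ‖f⁻¹ z‖ ≤ √ħ := by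
    rw [hψ, Complex.ofReal_re, mul_le_mul_iff_of_pos_left (by positivity), Real.exp_le_exp,
      Real.le_sqrt (norm_nonneg _) hħ.le, neg_mul, neg_le_neg_iff, one_div, inv_mul_le_iff₀ hħ,
      mul_one]
  obtain ⟨ψ, hψ⟩ := stateOf_nonempty hħ hf
  ext z
  rw [Equiv.image_eq_preimage_symm, Set.mem_preimage, mem_closedBall_zero_iff]
  exact ⟨fun ⟨φ, hφ, hz⟩ => (hle φ hφ z).1 hz, fun hz => ⟨ψ, hψ, (hle ψ hψ z).2 hz⟩⟩

section PosDef

variable {A B : Matrix (Fin n) (Fin n) ℝ}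

theorem blob_gaussState (hħ : 0 < ħ) (hA : A.PosDef) (hB : B.IsSymm) (z₀ : Phase n) :
    blob ħ (gaussState ħ z₀ A B)
      = translation z₀ '' (lin (matS A B) '' Metric.closedBall 0 √ħ) := by
  rw [gaussState_eq_stateOf hħ z₀ hA hB,
    blob_stateOf hħ (mul_mem (translation_mem_ISp z₀) (spMap_mem_ISp _)), Equiv.Perm.coe_mul,
    Set.image_comp]
  rfl

theorem blob_gaussState_eq_ellipsoid (hħ : 0 < ħ) (hA : A.PosDef) (hB : B.IsSymm)
    (z₀ : Phase n) :
    blob ħ (gaussState ħ z₀ A B) = {z | quad (matG A B) (z - z₀) ≤ ħ} := by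
  rw [gaussState_eq_stateOf hħ z₀ hA hB,
    blob_stateOf hħ (mul_mem (translation_mem_ISp z₀) (spMap_mem_ISp _)),
    Equiv.image_eq_preimage_symm]
  ext z
  rw [Set.mem_preimage, mem_closedBall_zero_iff, Set.mem_ofPred_eq, quad_matG_sub hA hB,
    Real.le_sqrt (norm_nonneg _) hħ.le]
  rfl

end PosDef

/-- The set of the images of the closed ball of radius `√ħ` about the origin under the elements
of `G`. -/
def blobsOf (ħ : ℝ) (G : Subgroup (Equiv.Perm (Phase n))) : Set (Set (Phase n)) :=
  {Q | ∃ f ∈ G, Q = f '' Metric.closedBall 0 √ħ}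

theorem QB₀_eq_blobsOf : QB₀ n ħ = blobsOf ħ (spMap n).range := by
  refine Set.Subset.antisymm ?_ ?_
  · rintro _ ⟨S, rfl⟩
    exact ⟨_, ⟨S, rfl⟩, rfl⟩
  · rintro _ ⟨_, ⟨S, rfl⟩, rfl⟩
    exact ⟨S, rfl⟩

theorem image_translation_closedBall (z₀ : Phase n) (r : ℝ) :
    translation z₀ '' Metric.closedBall 0 r = Metric.closedBall z₀ r := by
  simp [translation]

theorem QB_eq_blobsOf : QB n ħ = blobsOf ħ (ISp n) := by
  refine Set.Subset.antisymm ?_ ?_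
  · rintro _ ⟨S, z₀, rfl⟩
    exact ⟨_, ⟨S, z₀, rfl⟩,
      by rw [Equiv.Perm.coe_mul, Set.image_comp, image_translation_closedBall]⟩
  · rintro _ ⟨_, ⟨S, z₀, rfl⟩, rfl⟩
    exact ⟨S, z₀, by rw [Equiv.Perm.coe_mul, Set.image_comp, image_translation_closedBall]⟩

section BlobsOf

variable {G : Subgroup (Equiv.Perm (Phase n))} {Q Q' : Set (Phase n)}

theorem image_mem_blobsOf {f : Equiv.Perm (Phase n)} (hf : f ∈ G) (hQ : Q ∈ blobsOf ħ G) :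
    f '' Q ∈ blobsOf ħ G := by
  obtain ⟨g, hg, rfl⟩ := hQ
  exact ⟨f * g, mul_mem hf hg, by rw [Equiv.Perm.coe_mul, Set.image_comp]⟩

theorem exists_image_eq_of_mem_blobsOf (hQ : Q ∈ blobsOf ħ G) (hQ' : Q' ∈ blobsOf ħ G) :
    ∃ f ∈ G, f '' Q = Q' := by
  obtain ⟨g, hg, rfl⟩ := hQ
  obtain ⟨g', hg', rfl⟩ := hQ'
  exact ⟨g' * g⁻¹, mul_mem hg' (inv_mem hg), by
    rw [← Set.image_comp, ← Equiv.Perm.coe_mul, inv_mul_cancel_right]⟩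

theorem stateOf_eq_of_image_closedBall_eq (hħ : 0 < ħ) {f g : Equiv.Perm (Phase n)}
    (hf : f ∈ ISp n) (hg : g ∈ ISp n)
    (h : f '' Metric.closedBall 0 √ħ = g '' Metric.closedBall 0 √ħ) :
    stateOf ħ f = stateOf ħ g := by
  have hball : (g⁻¹ * f) '' Metric.closedBall 0 √ħ = Metric.closedBall 0 √ħ := by
    rw [Equiv.Perm.coe_mul, Set.image_comp, h, ← Set.image_comp, ← Equiv.Perm.coe_mul,
      inv_mul_cancel, Equiv.Perm.coe_one, Set.image_id]
  refine stateOf_congr fun z => ?_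
  have hnorm := norm_apply_eq_of_mem_ISp (mul_mem (inv_mem hg) hf) (Real.sqrt_pos.2 hħ) hball
    (f⁻¹ z)
  rw [Equiv.Perm.mul_apply, ← Equiv.Perm.mul_apply f, mul_inv_cancel] at hnorm
  exact hnorm.symm

theorem bijOn_blob (hħ : 0 < ħ) (hG : G ≤ ISp n) :
    Set.BijOn (blob ħ) (statesOf ħ G) (blobsOf ħ G) := by
  refine ⟨?_, ?_, ?_⟩
  · rintro _ ⟨f, hf, rfl⟩
    exact ⟨f, hf, blob_stateOf hħ (hG hf)⟩
  · rintro _ ⟨f, hf, rfl⟩ _ ⟨g, hg, rfl⟩ h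
    rw [blob_stateOf hħ (hG hf), blob_stateOf hħ (hG hg)] at h
    exact stateOf_eq_of_image_closedBall_eq hħ (hG hf) (hG hg) h
  · rintro _ ⟨f, hf, rfl⟩
    exact ⟨_, ⟨f, hf, rfl⟩, blob_stateOf hħ (hG hf)⟩

end BlobsOf

/-! ### The transitive actions on states -/

theorem exists_Mp_image_eq (hħ : 0 < ħ) {s s' : Set (L2 n)} (hs : s ∈ statesOf ħ (spMap n).range)
    (hs' : s' ∈ statesOf ħ (spMap n).range) : ∃ U : Mp n hħ, (U : UnitaryOp n) '' s = s' := by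
  obtain ⟨_, ⟨S, rfl⟩, hS⟩ := exists_forall_wignerCovariant_image_eq hs hs'
  obtain ⟨U, rfl⟩ := projMp_surjective hħ S
  exact ⟨U, hS U (wignerCovariant_projMp hħ U)⟩

theorem exists_Mp_mul_heisenberg_image_eq (hħ : 0 < ħ) {s s' : Set (L2 n)}
    (hs : s ∈ statesOf ħ (ISp n)) (hs' : s' ∈ statesOf ħ (ISp n)) :
    ∃ (U : Mp n hħ) (z₀ : Phase n), ((U : UnitaryOp n) * heisenberg ħ z₀) '' s = s' := by
  obtain ⟨_, ⟨S, z₀, rfl⟩, hS⟩ := exists_forall_wignerCovariant_image_eq hs hs'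
  obtain ⟨U, rfl⟩ := projMp_surjective hħ S
  exact ⟨U, z₀, hS _ ((wignerCovariant_projMp hħ U).mul (wignerCovariant_heisenberg ħ z₀))⟩

end QuantumBlob

theorem mainTheorem3 (n : ℕ) (ħ : ℝ) (hħ : 0 < ħ) :
    ∃ (Φ : Set (L2 n) → Set (Phase n)) (pr : Mp n hħ →* Sp n) (prI : IMp n hħ →* ISp n),
      -- the correspondence `Gauss(n) ↔ QB(n)` and the Wigner transform
      Set.BijOn Φ (Gauss n ħ) (QB n ħ) ∧
      Set.BijOn Φ (Gauss₀ n ħ) (QB₀ n ħ) ∧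
      (∀ (z₀ : Phase n) (A B : Matrix (Fin n) (Fin n) ℝ), A.PosDef → B.IsSymm →
        matS A B ∈ Sp n ∧
        Φ (gaussState ħ z₀ A B)
          = translation z₀ '' (lin (matS A B) '' Metric.closedBall 0 √ħ) ∧
        Φ (gaussState ħ z₀ A B) = {z | quad (matG A B) (z - z₀) ≤ ħ} ∧
        ∀ ψ : L2 n, ψ ∈ gaussState ħ z₀ A B ↔
          ∀ z : Phase n, wigner ħ ψ z = (((1 / (Real.pi * ħ)) ^ n
            * Real.exp (-(1 / ħ) * quad (matG A B) (z - z₀)) : ℝ) : ℂ)) ∧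
      -- the projections `Mp(n) → Sp(n)` and `IMp(n) → ISp(n)`
      ((pr ⟨opJ n hħ, opJ_mem n hħ⟩ : Matrix (Fin n ⊕ Fin n) (Fin n ⊕ Fin n) ℝ)
        = Matrix.fromBlocks 0 1 (-1) 0) ∧
      (∀ (P : Matrix (Fin n) (Fin n) ℝ) (hP : P.IsSymm),
        (pr ⟨opV ħ P, opV_mem hħ hP⟩ : Matrix (Fin n ⊕ Fin n) (Fin n ⊕ Fin n) ℝ)
          = Matrix.fromBlocks 1 0 (-P) 1) ∧
      (∀ (L : GL (Fin n) ℝ) (m : ℤ)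
        (hm : (-1 : ℝ) ^ m * |(L : Matrix (Fin n) (Fin n) ℝ).det|
          = (L : Matrix (Fin n) (Fin n) ℝ).det),
        (pr ⟨opM L m, opM_mem hħ hm⟩ : Matrix (Fin n ⊕ Fin n) (Fin n ⊕ Fin n) ℝ)
          = Matrix.fromBlocks (L : Matrix (Fin n) (Fin n) ℝ)⁻¹ 0 0
            (L : Matrix (Fin n) (Fin n) ℝ)ᵀ) ∧
      Function.Surjective pr ∧
      (∀ (U : Mp n hħ) (z₀ : Phase n),
        prI ⟨(U : UnitaryOp n) * heisenberg ħ z₀, Mp_mul_heisenberg_mem hħ U z₀⟩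
          = ⟨spMap n (pr U) * translation z₀, spMap_mul_translation_mem (pr U) z₀⟩) ∧
      Function.Surjective prI ∧
      -- the transitive action of `Sp(n)` on `QB₀(n)`
      (∀ S : Sp n, ∀ Q ∈ QB₀ n ħ, spMap n S '' Q ∈ QB₀ n ħ) ∧
      (∀ Q ∈ QB₀ n ħ, ∀ Q' ∈ QB₀ n ħ, ∃ S : Sp n, spMap n S '' Q = Q') ∧
      -- the induced transitive action of `Mp(n)` on `Gauss₀(n)`
      (∀ U : Mp n hħ, ∀ s ∈ Gauss₀ n ħ,
        (U : UnitaryOp n) '' s ∈ Gauss₀ n ħ ∧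
        Φ ((U : UnitaryOp n) '' s) = spMap n (pr U) '' Φ s) ∧
      (∀ s ∈ Gauss₀ n ħ, ∀ s' ∈ Gauss₀ n ħ, ∃ U : Mp n hħ, (U : UnitaryOp n) '' s = s') ∧
      -- the transitive action of `ISp(n)` on `QB(n)`
      (∀ f : ISp n, ∀ Q ∈ QB n ħ, (f : Equiv.Perm (Phase n)) '' Q ∈ QB n ħ) ∧
      (∀ Q ∈ QB n ħ, ∀ Q' ∈ QB n ħ, ∃ f : ISp n, (f : Equiv.Perm (Phase n)) '' Q = Q') ∧
      -- the induced transitive action of `IMp(n)` on `Gauss(n)`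
      (∀ U : IMp n hħ, ∀ s ∈ Gauss n ħ,
        (U : UnitaryOp n) '' s ∈ Gauss n ħ ∧
        Φ ((U : UnitaryOp n) '' s) = (prI U : Equiv.Perm (Phase n)) '' Φ s) ∧
      (∀ s ∈ Gauss n ħ, ∀ s' ∈ Gauss n ħ, ∃ (U : Mp n hħ) (z₀ : Phase n),
        ((U : UnitaryOp n) * heisenberg ħ z₀) '' s = s') := by
  rw [Gauss_eq_statesOf hħ, Gauss₀_eq_statesOf hħ, QB_eq_blobsOf, QB₀_eq_blobsOf]
  refine ⟨blob ħ, projMp hħ, projIMp hħ, bijOn_blob hħ le_rfl, bijOn_blob hħ range_spMap_le_ISp,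
    fun z₀ A B hA hB => ⟨matS_mem hA hB, blob_gaussState hħ hA hB z₀,
      blob_gaussState_eq_ellipsoid hħ hA hB z₀, mem_gaussState_iff hħ hA hB z₀⟩,
    by rw [projMp_opJ]; rfl, fun P hP => by rw [projMp_opV hħ hP]; rfl,
    fun L m hm => by rw [projMp_opM hħ hm]; rfl, projMp_surjective hħ, projIMp_mul_heisenberg hħ,
    projIMp_surjective hħ, fun S Q hQ => image_mem_blobsOf ⟨S, rfl⟩ hQ, fun Q hQ Q' hQ' => ?_,
    fun U s hs => ?_, fun s hs s' hs' => exists_Mp_image_eq hħ hs hs',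
    fun f Q hQ => image_mem_blobsOf f.2 hQ, fun Q hQ Q' hQ' => ?_, fun U s hs => ?_,
    fun s hs s' hs' => exists_Mp_mul_heisenberg_image_eq hħ hs hs'⟩
  · obtain ⟨_, ⟨S, rfl⟩, hS⟩ := exists_image_eq_of_mem_blobsOf hQ hQ'
    exact ⟨S, hS⟩
  · have hU := wignerCovariant_projMp hħ U
    exact ⟨hU.image_mem_statesOf (MonoidHom.mem_range.2 ⟨_, rfl⟩) hs, hU.blob_image s⟩
  · obtain ⟨f, hf, hfQ⟩ := exists_image_eq_of_mem_blobsOf hQ hQ'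
    exact ⟨⟨f, hf⟩, hfQ⟩
  · have hU := wignerCovariant_projIMp hħ U
    exact ⟨hU.image_mem_statesOf (projIMp hħ U).2 hs, hU.blob_image s⟩
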